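/- Conventions. A polytope is the convex hull of a finite subset of some $\mathbb{R}^m$; its dimension is that of its affine hull; $\mathcal{F}(P)$ is the set of nonempty faces of $P$, including $P$ itself. A triangulation of $P$ is a finite (geometric) simplicial complex with underlying set $P$. A triangulation $\mathcal{C}_P$ of $P$, together with a choice of a vertex $v_F$ of $F$ (the apex of $F$) for every $F\in\mathcal{F}(P)$, is called a pointed triangulation of $P$ if, with $\mathcal{C}_F$ the set of simplices of $\mathcal{C}_P$ contained in $F$: (1) for every $F\in\mathcal F(P)$, $\mathcal{C}_F$ is a triangulation of $F$ and $v_F$ lies in every simplex of $\mathcal{C}_F$ of dimension $\dim F$; (2) if $F_1,F_2\in\mathcal F(P)$ and $v_{F_1},v_{F_2}\in F_1\cap F_2$, then $v_{F_1}=v_{F_2}$; (3) for every $F\in\mathcal F(P)$ and every vertex $w\ne v_F$ of $F$, the edge $\mathrm{Conv}\{v_F,w\}$ belongs to $\mathcal{C}_F$. Given the apexes, the polytope numbers $P(n)$ and the interior polytope numbers $P(n)^\#$ ($n\ge 0$) are defined by induction on the dimension and on $n$. If $\dim P=0$, then $P(0)=P(0)^\#=0$ and $P(n)=P(n)^\#=1$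 for $n\ge1$. If $\dim P>0$, then $P(0)=P(0)^\#=0$, $P(1)=1$, $P(1)^\#=0$, and for $n\ge2$ $$P(n)=P(n-1)+\sum_{F\in\mathcal{F}(P),\ v_P\notin F}F(n)^\#,\qquad P(n)^\#=P(n)-\sum_{F\in\mathcal{F}(P)\setminus\{P\}}F(n)^\#.$$ The $h$-vector $(h_0,\dots,h_{d+1})$ of a $d$-dimensional simplicial complex with $f_i$ simplices of dimension $i$ (and $f_{-1}=1$) is given by $h_k=\sum_{i=0}^{k}(-1)^{k-i}\binom{d+1-i}{d+1-k}f_{i-1}$. The simplex numbers are $\alpha^d(n)=\binom{n+d-1}{d}$ for $n\ge1$ and $\alpha^d(n)=0$ for $n\le0$. Theorem. Let $d\ge1$ and let $P$ be a convex polytope of dimension $d$. Then $P$ has a pointed triangulation, and for every pointed triangulation $\mathcal{C}_P$ of $P$, with its apexes, the polytope numbers of $P$ with respect to these apexes satisfy $$P(n)=\sum_{j=0}^{d-1}h_j\,\alpha^d(n-j)\qquad\text{for all } n\ge0,$$ where $h_0,\dots,h_{d+1}$ is the $h$-vector of $\mathcal{C}_P$. -/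

import Mathlib

noncomputable section

namespace PolytopeNumbers

variable {E : Type*} [NormedAddCommGroup E] [NormedSpace ℝ E]

/-- A polytope is the convex hull of a finite set of points. -/
def IsPolytope (P : Set E) : Prop :=
  ∃ S : Finset E, P = convexHull ℝ (S : Set E)

/-- The dimension of (the affine hull of) a set. -/
def dim (P : Set E) : ℕ :=
  Module.finrank ℝ (vectorSpan ℝ P)

/-- `F` is a nonempty face of `P`: the set of points of `P` at which some linear functional attains
its maximum over `P`. The polytope `P` itself is a face (zero functional). -/
def IsFace (P F : Set E) : Prop :=
  IsExposed ℝ P F ∧ F.Nonempty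

/-- A nonempty face of `P` other than `P` itself. -/
def IsProperFace (P F : Set E) : Prop :=
  IsFace P F ∧ F ≠ P

/-- Proper faces have smaller dimension, so that recursion on the dimension is well founded. -/
theorem IsProperFace.dim_lt [FiniteDimensional ℝ E] {P F : Set E} (h : IsProperFace P F) :
    dim F < dim P := by
  obtain ⟨⟨hexp, hne⟩, hFP⟩ := h
  obtain ⟨l, rfl⟩ := hexp hne
  obtain ⟨x, hxP, hx⟩ := hne
  have hy : ∃ y ∈ P, l y < l x := by
    by_contra hcon
    push Not at hcon
    apply hFP
    ext z
    exact ⟨fun hz => hz.1, fun hz => ⟨hz, fun y hy => (hx y hy).trans (hcon z hz)⟩⟩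
  obtain ⟨y, hyP, hyx⟩ := hy
  apply Submodule.finrank_lt_finrank_of_lt
  refine lt_of_le_of_ne (vectorSpan_mono ℝ fun z hz => hz.1) fun heq => ?_
  have hker : vectorSpan ℝ {x | x ∈ P ∧ ∀ y ∈ P, l y ≤ l x} ≤ LinearMap.ker l.toLinearMap := by
    rw [vectorSpan_def, Submodule.span_le]
    rintro _ ⟨a, ha, b, hb, rfl⟩
    have h1 : l a = l b := le_antisymm (hb.2 a ha.1) (ha.2 b hb.1)
    simp [h1]
  have hmem : y - x ∈ vectorSpan ℝ P := vsub_mem_vectorSpan ℝ hyP hxP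
  rw [← heq] at hmem
  have h2 := hker hmem
  simp only [LinearMap.mem_ker, map_sub, ContinuousLinearMap.coe_coe] at h2
  linarith

mutual

/-- The polytope number `P(n)`, for a choice `v` of an apex `v F` of every face `F`.
It is `0` for `n = 0` and `1` for `n = 1`; in dimension `0` it is `1` for all `n ≥ 1`; and in
positive dimension, for `n ≥ 2`, it is `P(n - 1)` plus the sum of the interior polytope numbers
`F(n)^#` over the faces `F` of `P` that do not contain the apex of `P`. -/
def polytopeNumber [FiniteDimensional ℝ E] (v : Set E → E) (P : Set E) : ℕ → ℤ
  | 0 => 0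
  | 1 => 1
  | n + 2 =>
    if dim P = 0 then 1
    else polytopeNumber v P (n + 1) +
      ∑ᶠ F : {F : Set E // IsProperFace P F ∧ v P ∉ F}, interiorNumber v F.1 (n + 2)
termination_by n => (dim P, n, 0)
decreasing_by
  · simp [Prod.lex_def]
  · have := F.2.1.dim_lt
    simp [Prod.lex_def, this]

/-- The interior polytope number `P(n)^#`. It is `0` for `n = 0`; in dimension `0` it is `1` for
all `n ≥ 1`; and in positive dimension it is `0` for `n = 1`, and for `n ≥ 2` it is `P(n)` minus
the sum of the interior polytope numbers `F(n)^#` over the proper faces `F` of `P`. -/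
def interiorNumber [FiniteDimensional ℝ E] (v : Set E → E) (P : Set E) : ℕ → ℤ
  | 0 => 0
  | 1 => if dim P = 0 then 1 else 0
  | n + 2 =>
    if dim P = 0 then 1
    else polytopeNumber v P (n + 2) -
      ∑ᶠ F : {F : Set E // IsProperFace P F}, interiorNumber v F.1 (n + 2)
termination_by n => (dim P, n, 1)
decreasing_by
  · simp [Prod.lex_def]
  · have := F.2.dim_lt
    simp [Prod.lex_def, this]

end

/-- A (finite) triangulation of `P`. Simplices are stored as their vertex sets, and the empty
simplex is left implicit. -/
def IsTriangulation (P : Set E) (K : Geometry.SimplicialComplex ℝ E) : Prop :=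
  K.faces.Finite ∧ K.space = P

/-- The subcomplex of the simplices of `K` that are contained in `F`. -/
def restrict (K : Geometry.SimplicialComplex ℝ E) (F : Set E) : Geometry.SimplicialComplex ℝ E where
  faces := {s | s ∈ K.faces ∧ convexHull ℝ (s : Set E) ⊆ F}
  isRelLowerSet_faces := fun _ hs =>
    ⟨K.nonempty_of_mem_faces hs.1, fun _ hts ht =>
      ⟨K.down_closed hs.1 hts ht, (convexHull_mono (Finset.coe_subset.2 hts)).trans hs.2⟩⟩
  indep := fun hs => K.indep hs.1
  inter_subset_convexHull := fun hs ht => K.inter_subset_convexHull hs.1 ht.1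

/-- `K` is a pointed triangulation of `P`, and `v F` is the apex of every face `F` of `P`; the
triangulation of a face `F` is the one that `K` induces on it. -/
structure IsPointedTriangulation (P : Set E) (K : Geometry.SimplicialComplex ℝ E)
    (v : Set E → E) : Prop where
  isTriangulation : IsTriangulation P K
  isTriangulation_face : ∀ F, IsFace P F → IsTriangulation F (restrict K F)
  apex_mem_vertices : ∀ F, IsFace P F → v F ∈ F.extremePoints ℝ
  /-- The apex of a `k`-face `F` lies in every `k`-simplex of the triangulation of `F`. -/
  apex_mem_simplex : ∀ F, IsFace P F → ∀ s ∈ (restrict K F).faces, s.card = dim F + 1 → v F ∈ s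
  apex_eq : ∀ F₁ F₂, IsFace P F₁ → IsFace P F₂ →
    v F₁ ∈ F₁ ∩ F₂ → v F₂ ∈ F₁ ∩ F₂ → v F₁ = v F₂
  /-- The apex of `F` is joined by an edge to every other vertex of `F`. -/
  edge_mem : ∀ F, IsFace P F → ∀ w ∈ F.extremePoints ℝ, w ≠ v F →
    ∃ s ∈ (restrict K F).faces, (s : Set E) = {v F, w}

/-- The number `f_{i-1}` of simplices of `K` with `i` vertices, where the empty simplex counts as
a simplex of `K`; thus `f_{-1} = 1`. -/
def faceCount (K : Geometry.SimplicialComplex ℝ E) (i : ℕ) : ℕ :=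
  {s : Finset E | (s = ∅ ∨ s ∈ K.faces) ∧ s.card = i}.ncard

/-- The entry `h_k`, for `0 ≤ k ≤ d + 1`, of the `h`-vector of a `d`-dimensional complex `K`. -/
def hEntry (K : Geometry.SimplicialComplex ℝ E) (d k : ℕ) : ℤ :=
  ∑ i ∈ Finset.range (k + 1),
    (-1) ^ (k - i) * ((d + 1 - i).choose (d + 1 - k) : ℤ) * (faceCount K i : ℤ)

/-- The simplex number `α^d(m)`, which is `0` for `m ≤ 0`. -/
def simplexNumber (d : ℕ) (m : ℤ) : ℤ :=
  if m ≤ 0 then 0 else ((m.toNat + d - 1).choose d : ℤ)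

end PolytopeNumbers

end

/-!
The proof has two independent halves.

*Existence.* Order the vertices of `P` by an injective rank and let the apex of a face be its vertex
of smallest rank. The pulling triangulation is described without recursion: a set `s` of vertices is
a simplex if every nonempty `t ⊆ s` contains the apex of the smallest face around `t` (`IsPulled`).
A point of `P` other than the apex `a` of its smallest face `F` is reached from `a` by a ray that
leaves `P` at a point of a face without `a` (`exists_exit_point`). By induction on the dimension
this gives that the simplices cover `P` (`exists_isPulled_mem_convexHull`), and, as the exit point
is determined by the ray (`eq_of_lineMap_eq`), that their relative interiors are disjoint
(`IsPulled.eq_of_mem_openSimplex`).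

*The formula.* If all simplices of full dimension contain the apex `a` of `P`, the triangulation is
a cone with apex `a` over the simplices that lie in faces without `a`
(`IsTriangulation.exists_face_notMem`, `IsTriangulation.sum_cone`). The relative interior of each
simplex lies in that of exactly one face, so Pascal's rule turns the recursion for the polytope
numbers into `P(n + 2) = ∑ C(n, |s| - 1)`, summed over the simplices `s` (given by their
vertex sets), and `P(n + 2)^#` into the same sum over the simplices interior to `P`
(`IsPointedTriangulation.numbers_eq`). Iterated differences of simplex numbers are simplex numbers,
so this sum is `∑ h_j α^d(n + 2 - j)` over *all* `j ≤ d + 1` (`sum_hEntry_mul_simplexNumber`).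

It remains to see that `h_d = h_{d+1} = 0` (`IsTriangulation.alternating_sums`). For a generic point
`q` of `P`, each simplex `s`, including the empty one, belongs to exactly one full-dimensional
simplex `T` that is entered when moving from the center of `s` towards `q`
(`IsTriangulation.existsUnique_facet`). This splits the complex into intervals `[T \ U, T]`, where
`U` is the set of vertices of `T` at which `q` has a positive barycentric coordinate; an interval
contributes to `h_k` only if `|U| = d + 1 - k`. For `q` close to `a` the set `U` contains `a`, and
`U = {a}` would place `q` beyond a hyperplane that supports `P` at `a`. So `|U| ≥ 2` throughout.

The facts on polytopes that are used (a face of a face is a face, and a segment of `P` ending at `x`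
can be prolonged beyond `x` unless some face contains `x` but not the whole segment) come from
Farkas' lemma (`exists_nonneg_combination`) and the Krein-Milman theorem.
-/

noncomputable section

namespace PolytopeNumbers

variable {E : Type*} [NormedAddCommGroup E] [NormedSpace ℝ E]

/-! ### Farkas' lemma -/

/-- Farkas' lemma for a finitely generated cone: if every functional that is nonpositive on the
generators is nonpositive at `b`, then `b` is a nonnegative combination of the generators. -/
theorem exists_nonneg_combination {ι : Type*} (s : Finset ι) (a : ι → E) (b : E)
    (h : ∀ l : StrongDual ℝ E, (∀ i ∈ s, l (a i) ≤ 0) → l b ≤ 0) :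
    ∃ c : ι → ℝ, (∀ i ∈ s, 0 ≤ c i) ∧ b = ∑ i ∈ s, c i • a i := by
  classical
  induction s using Finset.induction_on generalizing a b with
  | empty =>
    refine ⟨0, by simp, ?_⟩
    by_contra hb
    obtain ⟨l, -, hl⟩ := exists_dual_vector ℝ b (by simpa using hb)
    have h1 := h l (by simp)
    rw [hl] at h1
    exact hb (norm_le_zero_iff.1 h1)
  | insert j s hj ih =>
    by_cases h0 : ∀ l : StrongDual ℝ E, (∀ i ∈ s, l (a i) ≤ 0) → l b ≤ 0
    · obtain ⟨c, hc, rfl⟩ := ih a b h0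
      refine ⟨Function.update c j 0, fun i hi => ?_, ?_⟩
      · by_cases hij : i = j
        · simp [hij]
        · simpa [hij] using hc i ((Finset.mem_insert.1 hi).resolve_left hij)
      · rw [Finset.sum_insert hj]
        simp only [Function.update_self, zero_smul, zero_add]
        refine Finset.sum_congr rfl fun i hi => ?_
        rw [Function.update_of_ne (ne_of_mem_of_not_mem hi hj)]
    · push Not at h0
      obtain ⟨l, hl, hlb⟩ := h0
      have hlj : 0 < l (a j) := by
        by_contra! hcon
        refine absurd (h l fun i hi => ?_) (not_le.2 hlb)
        rcases Finset.mem_insert.1 hi with rfl | hi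
        exacts [hcon, hl i hi]
      -- Project along `a j` onto the kernel of `l`.
      obtain ⟨c, hc, hcb⟩ := ih (fun i => a i - (l (a i) / l (a j)) • a j)
        (b - (l b / l (a j)) • a j) fun g hg => by
          have := h (g - (g (a j) / l (a j)) • l) fun i hi => by
            rcases Finset.mem_insert.1 hi with rfl | hi
            · simp [hlj.ne']
            · have := hg i hi
              simp only [map_sub, map_smul, smul_eq_mul] at this
              simp only [sub_apply, smul_apply,
                smul_eq_mul]
              linarith [show l (a i) / l (a j) * g (a j) = g (a j) / l (a j) * l (a i) by ring]
          simp only [sub_apply, smul_apply,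
            smul_eq_mul] at this
          simp only [map_sub, map_smul, smul_eq_mul]
          linarith [show l b / l (a j) * g (a j) = g (a j) / l (a j) * l b by ring]
      refine ⟨Function.update c j (l b / l (a j) - ∑ i ∈ s, c i * (l (a i) / l (a j))),
        fun i hi => ?_, ?_⟩
      · by_cases hij : i = j
        · subst hij
          have h1 : ∑ k ∈ s, c k * (l (a k) / l (a i)) ≤ 0 := Finset.sum_nonpos fun k hk =>
            mul_nonpos_of_nonneg_of_nonpos (hc k hk)
              (div_nonpos_of_nonpos_of_nonneg (hl k hk) hlj.le)
          have h2 : 0 ≤ l b / l (a i) := by positivity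
          simp only [Function.update_self]
          linarith
        · simpa [hij] using hc i ((Finset.mem_insert.1 hi).resolve_left hij)
      · rw [Finset.sum_insert hj, Function.update_self]
        have h3 : ∑ i ∈ s, Function.update c j (l b / l (a j) -
            ∑ i ∈ s, c i * (l (a i) / l (a j))) i • a i = ∑ i ∈ s, c i • a i :=
          Finset.sum_congr rfl fun i hi => by
            rw [Function.update_of_ne (ne_of_mem_of_not_mem hi hj)]
        rw [h3, sub_smul, Finset.sum_smul]
        simp only [smul_sub, smul_smul, Finset.sum_sub_distrib] at hcb
        rw [sub_eq_iff_eq_add] at hcb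
        refine hcb.trans ?_
        abel

/-! ### Faces of polytopes -/

section Faces

variable {P F G : Set E} {x y : E}

theorem IsPolytope.convex (hP : IsPolytope P) : Convex ℝ P := by
  obtain ⟨S, rfl⟩ := hP
  exact convex_convexHull ℝ _

theorem IsPolytope.isCompact (hP : IsPolytope P) : IsCompact P := by
  obtain ⟨S, rfl⟩ := hP
  exact S.finite_toSet.isCompact_convexHull ℝ

theorem IsPolytope.finite_extremePoints (hP : IsPolytope P) : (P.extremePoints ℝ).Finite := by
  obtain ⟨S, rfl⟩ := hP
  exact S.finite_toSet.subset extremePoints_convexHull_subset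

/-- The Krein-Milman theorem for a set with finitely many extreme points needs no closure. -/
theorem convexHull_extremePoints_of_finite (hc : IsCompact P) (hP : Convex ℝ P)
    (hfin : (P.extremePoints ℝ).Finite) : convexHull ℝ (P.extremePoints ℝ) = P := by
  rw [← (hfin.isCompact_convexHull ℝ).isClosed.closure_eq]
  exact closure_convexHull_extremePoints hc hP

theorem IsPolytope.convexHull_extremePoints (hP : IsPolytope P) :
    convexHull ℝ (P.extremePoints ℝ) = P :=
  convexHull_extremePoints_of_finite hP.isCompact hP.convex hP.finite_extremePoints

theorem IsFace.subset (h : IsFace P F) : F ⊆ P := h.1.subset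

theorem IsFace.refl (hP : P.Nonempty) : IsFace P P := ⟨IsExposed.refl P, hP⟩

theorem IsFace.isPolytope (hP : IsPolytope P) (h : IsFace P F) : IsPolytope F := by
  have hfin : (F.extremePoints ℝ).Finite :=
    hP.finite_extremePoints.subset h.1.isExtreme.extremePoints_subset_extremePoints
  refine ⟨hfin.toFinset, ?_⟩
  rw [hfin.coe_toFinset]
  exact (convexHull_extremePoints_of_finite (h.1.isCompact hP.isCompact) (h.1.convex hP.convex)
    hfin).symm

theorem IsFace.extremePoints_eq (h : IsFace P F) :
    F.extremePoints ℝ = F ∩ P.extremePoints ℝ := h.1.isExtreme.extremePoints_eq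

theorem IsFace.eq_convexHull (hP : IsPolytope P) (h : IsFace P F) :
    F = convexHull ℝ (F ∩ P.extremePoints ℝ) := by
  rw [← h.extremePoints_eq, (h.isPolytope hP).convexHull_extremePoints]

theorem IsPolytope.finite_faces (hP : IsPolytope P) : {F | IsFace P F}.Finite := by
  refine (hP.finite_extremePoints.finite_subsets.image (convexHull ℝ)).subset fun F hF => ?_
  exact ⟨_, Set.inter_subset_right, (hF.eq_convexHull hP).symm⟩

theorem IsFace.mono (hG : IsFace P G) (hGF : G ⊆ F) (hFP : F ⊆ P) : IsFace F G :=
  ⟨hG.1.mono hFP hGF, hG.2⟩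

theorem IsFace.mem_of_mem_openSegment (hF : IsFace P F) {z : E} (hx : x ∈ P) (hy : y ∈ P)
    (hz : z ∈ F) (h : z ∈ openSegment ℝ x y) : x ∈ F :=
  hF.1.isExtreme.left_mem_of_mem_openSegment hx hy hz h

/-- A face is cut out by a functional whose values on the rest of the polytope are smaller. -/
theorem IsFace.exists_functional (hF : IsFace P F) : ∃ (l : StrongDual ℝ E) (m : ℝ),
    (∀ y ∈ F, l y = m) ∧ (∀ y ∈ P, l y ≤ m) ∧ ∀ y ∈ P, y ∉ F → l y < m := by
  obtain ⟨l, hl⟩ := hF.1 hF.2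
  obtain ⟨x, hx⟩ := hF.2
  have hx' := hx
  rw [hl] at hx'
  refine ⟨l, l x, fun y hy => ?_, hx'.2, fun y hy hyF => ?_⟩
  · have hy' := hy
    rw [hl] at hy'
    exact le_antisymm (hx'.2 y hy'.1) (hy'.2 x hx'.1)
  · refine lt_of_le_of_ne (hx'.2 y hy) fun heq => hyF ?_
    rw [hl]
    exact ⟨hy, fun z hz => heq ▸ hx'.2 z hz⟩

theorem isFace_of_functional {l : StrongDual ℝ E} {m : ℝ} (hF : F.Nonempty) (hFP : F ⊆ P)
    (h1 : ∀ y ∈ F, l y = m) (h2 : ∀ y ∈ P, y ∉ F → l y < m) : IsFace P F := by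
  refine ⟨fun _ => ⟨l, ?_⟩, hF⟩
  obtain ⟨x, hx⟩ := hF
  ext y
  refine ⟨fun hy => ⟨hFP hy, fun z hz => ?_⟩, fun hy => ?_⟩
  · rw [h1 y hy]
    by_cases hzF : z ∈ F
    exacts [(h1 z hzF).le, (h2 z hz hzF).le]
  · by_contra hyF
    have := hy.2 x (hFP hx)
    rw [h1 x hx] at this
    exact absurd (h2 y hy.1 hyF) (not_lt.2 this)

/-- If a functional is at most `m` on `V`, a point of the convex hull of `V` with value `m` is a
combination of points of `V` with value `m`. -/
theorem convexHull_inter_of_functional {V : Set E} {l : StrongDual ℝ E} {m : ℝ}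
    (h1 : ∀ y ∈ V, l y ≤ m) (hx : x ∈ convexHull ℝ V) (hxm : l x = m) :
    x ∈ convexHull ℝ {y ∈ V | l y = m} := by
  obtain ⟨ι, t, w, z, hw, hw1, hz, rfl⟩ := (convexHull_eq (R := ℝ) V).subset hx
  have hsum : ∑ i ∈ t, w i * (m - l (z i)) = 0 := by
    rw [Finset.centerMass_eq_of_sum_1 _ _ hw1] at hxm
    simp only [map_sum, map_smul, smul_eq_mul] at hxm
    simp only [mul_sub, Finset.sum_sub_distrib, ← Finset.sum_mul, hw1, hxm]
    ring
  rw [Finset.sum_eq_zero_iff_of_nonneg fun i hi =>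
    mul_nonneg (hw i hi) (sub_nonneg.2 (h1 _ (hz i hi)))] at hsum
  classical
  rw [← Finset.centerMass_filter_ne_zero]
  refine Finset.centerMass_mem_convexHull _ (fun i hi => hw i (Finset.mem_filter.1 hi).1) ?_ ?_
  · rw [Finset.sum_filter_ne_zero, hw1]
    exact one_pos
  · intro i hi
    obtain ⟨hi, hne⟩ := Finset.mem_filter.1 hi
    have := (mul_eq_zero.1 (hsum i hi)).resolve_left hne
    exact ⟨hz i hi, by linarith⟩

theorem IsFace.trans (hP : IsPolytope P) (hF : IsFace P F) (hG : IsFace F G) : IsFace P G := by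
  obtain ⟨l, m, hl1, hl2, hl3⟩ := hF.exists_functional
  obtain ⟨g, k, hg1, hg2, hg3⟩ := hG.exists_functional
  -- `g + N l` exposes `G` as soon as it is smaller than `k + N m` at the vertices off `F`.
  have hN : ∃ N : ℝ, ∀ y ∈ P.extremePoints ℝ, y ∉ F → g y - k < N * (m - l y) := by
    have hfin := hP.finite_extremePoints
    obtain ⟨N, hN⟩ := (hfin.image fun y => (g y - k) / (m - l y)).bddAbove
    refine ⟨N + 1, fun y hy hyF => ?_⟩
    have h1 : 0 < m - l y := sub_pos.2 (hl3 y hy.1 hyF)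
    have h2 := hN ⟨y, hy, rfl⟩
    simp only [div_le_iff₀ h1] at h2
    nlinarith
  obtain ⟨N, hN⟩ := hN
  have hval : ∀ y ∈ P.extremePoints ℝ, (g + N • l) y ≤ k + N * m ∧
      ((g + N • l) y = k + N * m → y ∈ G) := by
    intro y hy
    simp only [add_apply, smul_apply, smul_eq_mul]
    by_cases hyF : y ∈ F
    · rw [hl1 y hyF]
      refine ⟨by linarith [hg2 y hyF], fun h => ?_⟩
      by_contra hyG
      linarith [hg3 y hyF hyG]
    · have := hN y hy hyF
      exact ⟨by linarith, fun h => by linarith⟩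
  refine isFace_of_functional (l := g + N • l) (m := k + N * m) hG.2
    (hG.subset.trans hF.subset) (fun y hy => ?_) fun y hy hyG => ?_
  · simp [hg1 y hy, hl1 y (hG.subset hy)]
  · have hyc : y ∈ convexHull ℝ (P.extremePoints ℝ) := hP.convexHull_extremePoints.symm ▸ hy
    refine lt_of_le_of_ne ?_ fun heq => hyG ?_
    · exact convexHull_min (fun z hz => (hval z hz).1)
        (convex_halfSpace_le (g + N • l).toLinearMap.isLinear _) hyc
    · refine convexHull_min (fun z hz => (hval z hz.1).2 hz.2)
        (((hG.1.convex (hF.1.convex hP.convex))))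
        (convexHull_inter_of_functional (fun z hz => (hval z hz).1) hyc heq)

/-- If every face through `x` contains `y`, then the segment from `y` to `x` can be prolonged
beyond `x` inside the polytope. -/
theorem IsPolytope.exists_prolong (hP : IsPolytope P) (hx : x ∈ P)
    (h : ∀ F, IsFace P F → x ∈ F → y ∈ F) : ∃ ε : ℝ, 0 < ε ∧ x + ε • (x - y) ∈ P := by
  obtain ⟨S, hS⟩ := id hP
  obtain ⟨c, hc, hcx⟩ := exists_nonneg_combination S (fun z => z - x) (x - y) fun l hl => by
    have hle : ∀ z ∈ P, l z ≤ l x := by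
      rw [hS]
      exact fun z hz => convexHull_min (fun z hz => by simpa using hl z hz)
        (convex_halfSpace_le l.toLinearMap.isLinear _) hz
    have := (h {z ∈ P | ∀ y ∈ P, l y ≤ l z} ⟨fun _ => ⟨l, rfl⟩, x, hx, hle⟩ ⟨hx, hle⟩).2 x hx
    simpa using this
  have hpos : 0 < 1 + ∑ z ∈ S, c z := by
    have := Finset.sum_nonneg hc
    linarith
  refine ⟨(1 + ∑ z ∈ S, c z)⁻¹, inv_pos.2 hpos, ?_⟩
  have hsum : x + (1 + ∑ z ∈ S, c z)⁻¹ • (x - y) =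
      (1 + ∑ z ∈ S, c z)⁻¹ • x + ((1 + ∑ z ∈ S, c z)⁻¹ * ∑ z ∈ S, c z) •
        (S.centerMass c id) := by
    by_cases h0 : ∑ z ∈ S, c z = 0
    · have hz := (Finset.sum_eq_zero_iff_of_nonneg hc).1 h0
      rw [Finset.sum_eq_zero fun z hzS => by rw [hz z hzS, zero_smul]] at hcx
      simp [h0, hcx]
    · rw [Finset.centerMass, smul_smul, mul_assoc, mul_inv_cancel₀ h0, mul_one, hcx]
      simp only [smul_sub, Finset.sum_sub_distrib, ← Finset.sum_smul, id]
      have : x = (1 + ∑ z ∈ S, c z)⁻¹ • ((1 + ∑ z ∈ S, c z) • x) := by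
        rw [smul_smul, inv_mul_cancel₀ hpos.ne', one_smul]
      nth_rw 1 [this]
      simp only [add_smul, smul_add, one_smul]
      abel
  rw [hsum]
  by_cases h0 : ∑ z ∈ S, c z = 0
  · simpa [h0] using hx
  · refine hP.convex hx ?_ (inv_pos.2 hpos).le
      (mul_nonneg (inv_pos.2 hpos).le (Finset.sum_nonneg hc)) (by field_simp)
    rw [hS]
    exact Finset.centerMass_mem_convexHull _ hc
      (lt_of_le_of_ne (Finset.sum_nonneg hc) (Ne.symm h0)) fun z hz => hz

/-- The smallest face of `P` that contains `x`. -/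
def carrier (P : Set E) (x : E) : Set E := ⋂₀ {F | IsFace P F ∧ x ∈ F}

theorem mem_carrier : x ∈ carrier P x := fun _ hF => hF.2

theorem carrier_subset (hF : IsFace P F) (hx : x ∈ F) : carrier P x ⊆ F :=
  Set.sInter_subset_of_mem ⟨hF, hx⟩

theorem isFace_carrier (hP : IsPolytope P) (hx : x ∈ P) : IsFace P (carrier P x) := by
  have hfin : {F | IsFace P F ∧ x ∈ F}.Finite := hP.finite_faces.subset fun F hF => hF.1
  refine ⟨?_, x, mem_carrier⟩
  have := IsExposed.sInter (𝕜 := ℝ) (A := P) (F := hfin.toFinset)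
    ⟨P, by simpa using ⟨IsFace.refl ⟨x, hx⟩, hx⟩⟩
    (fun F hF => (hfin.mem_toFinset.1 hF).1.1)
  rwa [hfin.coe_toFinset] at this

theorem carrier_subset_iff (hF : IsFace P F) : carrier P x ⊆ F ↔ x ∈ F :=
  ⟨fun h => h mem_carrier, carrier_subset hF⟩

/-- `x` is a relative interior point of its carrier. -/
theorem exists_prolong_carrier (hP : IsPolytope P) (hx : x ∈ P) (hy : y ∈ carrier P x) :
    ∃ ε : ℝ, 0 < ε ∧ x + ε • (x - y) ∈ P :=
  hP.exists_prolong hx fun _ hF hxF => carrier_subset hF hxF hy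

theorem mem_openSegment_prolong (x y : E) {ε : ℝ} (hε : 0 < ε) :
    x ∈ openSegment ℝ y (x + ε • (x - y)) := by
  refine ⟨ε / (1 + ε), 1 / (1 + ε), by positivity, by positivity, by field_simp; ring, ?_⟩
  have h1 : (1 + ε) • ((ε / (1 + ε)) • y + (1 / (1 + ε)) • (x + ε • (x - y))) = (1 + ε) • x := by
    rw [smul_add, smul_smul, smul_smul, mul_div_cancel₀ _ (by positivity),
      mul_div_cancel₀ _ (by positivity)]
    module
  exact smul_right_injective E (by positivity : (1 + ε) ≠ 0) h1

end Faces

/-! ### Barycentric coordinates and open simplices -/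

section Simplices

open Finset

variable {s t : Finset E} {x y w : E} {P F : Set E}

theorem exists_affine_coord (hs : AffineIndependent ℝ ((↑) : s → E)) :
    ∃ c : E → E →ᵃ[ℝ] ℝ, ∀ w ∈ s, ∀ e ∈ s, (e = w → c w e = 1) ∧ (e ≠ w → c w e = 0) := by
  classical
  obtain ⟨t, hst, ht, htop⟩ := exists_subset_affineIndependent_affineSpan_eq_top
    (k := ℝ) (s := (s : Set E)) hs
  let b : AffineBasis t ℝ E := ⟨(↑), ht, by rwa [Subtype.range_coe]⟩
  refine ⟨fun w => if h : w ∈ t then b.coord ⟨w, h⟩ else 0, fun w hw e he => ?_⟩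
  have hwt : w ∈ t := hst hw
  have het : e ∈ t := hst he
  have hbe : e = b ⟨e, het⟩ := rfl
  simp only [hwt, dif_pos]
  rw [hbe, b.coord_apply]
  simp only [Subtype.mk.injEq]
  rw [← hbe]
  constructor
  · rintro rfl
    simp
  · intro h
    rw [if_neg (Ne.symm h)]

open Classical in
/-- The barycentric coordinate of the simplex `s` at its vertex `w`, extended (in an arbitrary way)
to an affine function on the whole space. It is the zero function if `s` is not affinely
independent. -/
def coord (s : Finset E) : E → E →ᵃ[ℝ] ℝ :=
  if h : AffineIndependent ℝ ((↑) : s → E) then (exists_affine_coord h).choose else 0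

theorem coord_self (hs : AffineIndependent ℝ ((↑) : s → E)) (hw : w ∈ s) : coord s w w = 1 := by
  rw [coord, dif_pos hs]
  exact ((exists_affine_coord hs).choose_spec w hw w hw).1 rfl

theorem coord_of_ne (hs : AffineIndependent ℝ ((↑) : s → E)) (hw : w ∈ s) (hx : x ∈ s)
    (hne : x ≠ w) : coord s w x = 0 := by
  rw [coord, dif_pos hs]
  exact ((exists_affine_coord hs).choose_spec w hw x hx).2 hne

theorem affineMap_sum_smul {F' : Type*} [AddCommGroup F'] [Module ℝ F'] (f : E →ᵃ[ℝ] F')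
    {a : E → ℝ} (ha : ∑ e ∈ s, a e = 1) :
    f (∑ e ∈ s, a e • e) = ∑ e ∈ s, a e • f e := by
  have h : ∀ x, f x = f.linear x + f 0 := fun x => congrFun f.decomp x
  have h2 : ∀ e ∈ s, a e • f e = f.linear (a e • e) + a e • f 0 := fun e _ => by
    rw [h e, smul_add, map_smul]
  rw [Finset.sum_congr rfl h2, Finset.sum_add_distrib, ← Finset.sum_smul, ha, one_smul, h, map_sum]

theorem coord_sum_smul (hs : AffineIndependent ℝ ((↑) : s → E)) (hw : w ∈ s) {a : E → ℝ}
    (ha : ∑ e ∈ s, a e = 1) : coord s w (∑ e ∈ s, a e • e) = a w := by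
  rw [affineMap_sum_smul _ ha, Finset.sum_eq_single w]
  · simp [coord_self hs hw]
  · intro e he hne
    simp [coord_of_ne hs hw he hne]
  · exact fun h => absurd hw h

theorem sum_smul_mem_affineSpan {a : E → ℝ} (hst : s ⊆ t) (ha : ∑ e ∈ s, a e = 1) :
    ∑ e ∈ s, a e • e ∈ affineSpan ℝ (t : Set E) := by
  have h := affineCombination_mem_affineSpan (k := ℝ) (s := s.attach) (w := fun i => a i)
    (by rw [Finset.sum_attach s a, ha]) ((↑) : s → E)
  rw [Finset.affineCombination_eq_linear_combination _ _ _ (by rw [Finset.sum_attach s a, ha]),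
    Finset.sum_attach s fun e => a e • e] at h
  refine affineSpan_mono ℝ ?_ h
  rw [Subtype.range_coe_subtype]
  exact fun e he => hst he

theorem exists_weights_of_mem_affineSpan (hx : x ∈ affineSpan ℝ (s : Set E)) :
    ∃ a : E → ℝ, ∑ e ∈ s, a e = 1 ∧ ∑ e ∈ s, a e • e = x := by
  classical
  have hx' : x ∈ affineSpan ℝ (Set.range ((↑) : s → E)) := by
    rw [Subtype.range_coe_subtype]
    exact hx
  obtain ⟨a, ha, rfl⟩ := eq_affineCombination_of_mem_affineSpan_of_fintype hx'
  refine ⟨fun e => if h : e ∈ s then a ⟨e, h⟩ else 0, ?_, ?_⟩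
  · rw [← ha, ← Finset.sum_attach s]
    exact Finset.sum_congr rfl fun e _ => by simp
  · rw [Finset.affineCombination_eq_linear_combination _ _ _ ha, ← Finset.sum_attach s]
    exact Finset.sum_congr rfl fun e _ => by simp

theorem sum_coord (hs : AffineIndependent ℝ ((↑) : s → E)) (hx : x ∈ affineSpan ℝ (s : Set E)) :
    ∑ e ∈ s, coord s e x = 1 ∧ ∑ e ∈ s, coord s e x • e = x := by
  obtain ⟨a, ha, rfl⟩ := exists_weights_of_mem_affineSpan hx
  have h : ∀ e ∈ s, coord s e (∑ e ∈ s, a e • e) = a e := fun e he => coord_sum_smul hs he ha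
  exact ⟨by rw [Finset.sum_congr rfl h, ha], Finset.sum_congr rfl fun e he => by rw [h e he]⟩

/-- If a barycentric coordinate vanishes, the point lies in the span of the opposite facet. -/
theorem mem_affineSpan_erase [DecidableEq E] (hs : AffineIndependent ℝ ((↑) : s → E))
    (hx : x ∈ affineSpan ℝ (s : Set E)) (hw : w ∈ s) (h : coord s w x = 0) :
    x ∈ affineSpan ℝ ((s.erase w : Finset E) : Set E) := by
  obtain ⟨h1, h2⟩ := sum_coord hs hx
  rw [← Finset.add_sum_erase s _ hw, h, zero_add] at h1
  rw [← Finset.add_sum_erase s _ hw, h, zero_smul, zero_add] at h2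
  rw [← h2]
  exact sum_smul_mem_affineSpan subset_rfl h1

theorem mem_convexHull_iff_coord (hs : AffineIndependent ℝ ((↑) : s → E)) :
    x ∈ convexHull ℝ (s : Set E) ↔
      x ∈ affineSpan ℝ (s : Set E) ∧ ∀ w ∈ s, 0 ≤ coord s w x := by
  refine ⟨fun hx => ⟨convexHull_subset_affineSpan _ hx, fun w hw => ?_⟩, fun ⟨hx, h⟩ => ?_⟩
  · obtain ⟨a, ha, ha1, rfl⟩ := Finset.mem_convexHull'.1 hx
    rw [coord_sum_smul hs hw ha1]
    exact ha w hw
  · obtain ⟨h1, h2⟩ := sum_coord hs hx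
    exact Finset.mem_convexHull'.2 ⟨fun e => coord s e x, h, h1, h2⟩

theorem coord_eq_zero_of_mem_convexHull (hs : AffineIndependent ℝ ((↑) : s → E)) {T : Set E}
    (hT : T ⊆ s) (hw : w ∈ s) (hwt : w ∉ T) (hx : x ∈ convexHull ℝ T) : coord s w x = 0 := by
  have h : convexHull ℝ T ⊆ (coord s w) ⁻¹' {0} :=
    convexHull_min (fun e he => coord_of_ne hs hw (hT he) (ne_of_mem_of_not_mem he hwt))
      ((convex_singleton (0 : ℝ)).affine_preimage _)
  exact h hx

/-- The relative interior of the simplex with vertex set `s`: the combinations of its vertices with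
positive weights. -/
def openSimplex (s : Finset E) : Set E :=
  {x | ∃ a : E → ℝ, (∀ e ∈ s, 0 < a e) ∧ ∑ e ∈ s, a e = 1 ∧ ∑ e ∈ s, a e • e = x}

theorem openSimplex_subset_convexHull : openSimplex s ⊆ convexHull ℝ (s : Set E) := by
  rintro x ⟨a, ha, ha1, rfl⟩
  exact Finset.mem_convexHull'.2 ⟨a, fun e he => (ha e he).le, ha1, rfl⟩

theorem openSimplex_nonempty_index (hx : x ∈ openSimplex s) : s.Nonempty := by
  obtain ⟨a, -, ha, -⟩ := hx
  by_contra h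
  simp [Finset.not_nonempty_iff_eq_empty.1 h] at ha

theorem coord_pos_of_mem_openSimplex (hs : AffineIndependent ℝ ((↑) : s → E))
    (hx : x ∈ openSimplex s) (hw : w ∈ s) : 0 < coord s w x := by
  obtain ⟨a, ha, ha1, rfl⟩ := hx
  rw [coord_sum_smul hs hw ha1]
  exact ha w hw

/-- Barycentric coordinates, with respect to a simplex, of a point in the relative interior of one
of its faces. -/
theorem coord_of_mem_openSimplex_subset (ht : AffineIndependent ℝ ((↑) : t → E)) (hst : s ⊆ t)
    (hx : x ∈ openSimplex s) (hw : w ∈ t) :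
    (w ∈ s → 0 < coord t w x) ∧ (w ∉ s → coord t w x = 0) := by
  classical
  refine ⟨fun hws => ?_, fun hws => coord_eq_zero_of_mem_convexHull ht (coe_subset.2 hst) hw hws
    (openSimplex_subset_convexHull hx)⟩
  obtain ⟨a, ha, ha1, rfl⟩ := hx
  rw [affineMap_sum_smul _ ha1, Finset.sum_eq_single_of_mem w hws fun e he hne => by
    simp [coord_of_ne ht hw (hst he) hne], coord_self ht hw]
  simpa using ha w hws

theorem mem_openSimplex_of_coord (hs : AffineIndependent ℝ ((↑) : s → E))
    (hx : x ∈ affineSpan ℝ (s : Set E)) (h : ∀ w ∈ s, 0 < coord s w x) : x ∈ openSimplex s :=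
  ⟨fun e => coord s e x, h, sum_coord hs hx⟩

theorem exists_mem_openSimplex (hx : x ∈ convexHull ℝ (s : Set E)) :
    ∃ t ⊆ s, t.Nonempty ∧ x ∈ openSimplex t := by
  classical
  obtain ⟨a, ha, ha1, hax⟩ := Finset.mem_convexHull'.1 hx
  have hx' : x ∈ openSimplex (s.filter fun e => a e ≠ 0) := by
    refine ⟨a, fun e he => ?_, ?_, ?_⟩
    · obtain ⟨he, hne⟩ := Finset.mem_filter.1 he
      exact lt_of_le_of_ne (ha e he) (Ne.symm hne)
    · rw [Finset.sum_filter_ne_zero, ha1]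
    · rw [← hax]
      refine Finset.sum_subset (Finset.filter_subset _ _) fun e he hne => ?_
      have : a e = 0 := by simpa [he] using hne
      rw [this, zero_smul]
  exact ⟨_, Finset.filter_subset _ _, openSimplex_nonempty_index hx', hx'⟩

/-- The barycenter of the vertices of a simplex. -/
def center (s : Finset E) : E := ∑ e ∈ s, (#s : ℝ)⁻¹ • e

theorem center_mem_openSimplex (hs : s.Nonempty) : center s ∈ openSimplex s := by
  have h : (0 : ℝ) < #s := by exact_mod_cast hs.card_pos
  exact ⟨fun _ => (#s : ℝ)⁻¹, fun _ _ => inv_pos.2 h, by simp [h.ne'], rfl⟩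

/-- A face of a convex set that meets the relative interior of a simplex contains the simplex. -/
theorem IsFace.convexHull_subset (hP : Convex ℝ P) (hF : IsFace P F) (hs : (s : Set E) ⊆ P)
    (hx : x ∈ openSimplex s) (hxF : x ∈ F) : convexHull ℝ (s : Set E) ⊆ F := by
  obtain ⟨l, m, hl1, hl2, hl3⟩ := hF.exists_functional
  refine convexHull_min (fun e he => ?_) (hF.1.convex hP)
  obtain ⟨a, ha, ha1, rfl⟩ := hx
  have hsum : ∑ e ∈ s, a e * (m - l e) = 0 := by
    have := hl1 _ hxF
    simp only [map_sum, map_smul, smul_eq_mul] at this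
    simp only [mul_sub, Finset.sum_sub_distrib, ← Finset.sum_mul, ha1, this]
    ring
  rw [Finset.sum_eq_zero_iff_of_nonneg fun e he =>
    mul_nonneg (ha e he).le (sub_nonneg.2 (hl2 _ (hs he)))] at hsum
  by_contra heF
  have h1 := (mul_eq_zero.1 (hsum e he)).resolve_left (ha e he).ne'
  linarith [hl3 e (hs he) heF]

end Simplices

/-! ### Simplicial complexes and dimension -/

section Complexes

open Finset Geometry

variable {K : SimplicialComplex ℝ E} {s t : Finset E} {x y w : E} {P F : Set E}

/-- A simplex that contains a point of the relative interior of `s` has `s` as a face. -/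
theorem subset_of_mem_openSimplex (hs : s ∈ K.faces) (ht : t ∈ K.faces) (hx : x ∈ openSimplex s)
    (hxt : x ∈ convexHull ℝ (t : Set E)) : s ⊆ t := by
  intro w hw
  by_contra hwt
  have h := K.inter_subset_convexHull hs ht ⟨openSimplex_subset_convexHull hx, hxt⟩
  have h0 := coord_eq_zero_of_mem_convexHull (K.indep hs) (T := (s ∩ t : Set E))
    Set.inter_subset_left hw (fun h => hwt h.2) h
  exact absurd (coord_pos_of_mem_openSimplex (K.indep hs) hx hw) (by simp [h0])

theorem eq_of_mem_openSimplex (hs : s ∈ K.faces) (ht : t ∈ K.faces) (hx : x ∈ openSimplex s)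
    (hxt : x ∈ openSimplex t) : s = t :=
  (subset_of_mem_openSimplex hs ht hx (openSimplex_subset_convexHull hxt)).antisymm
    (subset_of_mem_openSimplex ht hs hxt (openSimplex_subset_convexHull hx))

theorem exists_face_mem_openSimplex (hx : x ∈ K.space) : ∃ s ∈ K.faces, x ∈ openSimplex s := by
  obtain ⟨s, hs, hxs⟩ := SimplicialComplex.mem_space_iff.1 hx
  obtain ⟨t, hts, ht, hxt⟩ := exists_mem_openSimplex hxs
  exact ⟨t, K.down_closed hs hts ht, hxt⟩

theorem IsTriangulation.convexHull_subset (h : IsTriangulation P K) (hs : s ∈ K.faces) :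
    convexHull ℝ (s : Set E) ⊆ P := h.2 ▸ SimplicialComplex.convexHull_subset_space hs

theorem IsTriangulation.subset (h : IsTriangulation P K) (hs : s ∈ K.faces) : (s : Set E) ⊆ P :=
  (subset_convexHull ℝ _).trans (h.convexHull_subset hs)

/-- A triangulation of a convex set restricts to a triangulation of each of its faces. -/
theorem IsTriangulation.restrict (hP : Convex ℝ P) (h : IsTriangulation P K) (hF : IsFace P F) :
    IsTriangulation F (restrict K F) := by
  refine ⟨h.1.subset fun s hs => hs.1, Set.Subset.antisymm (fun x hx => ?_) fun x hx => ?_⟩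
  · obtain ⟨s, hs, hxs⟩ := SimplicialComplex.mem_space_iff.1 hx
    exact hs.2 hxs
  · obtain ⟨s, hs, hxs⟩ := exists_face_mem_openSimplex (K := K) (h.2.symm ▸ hF.subset hx)
    exact SimplicialComplex.mem_space_iff.2 ⟨s, ⟨hs, hF.convexHull_subset hP (h.subset hs) hxs hx⟩,
      openSimplex_subset_convexHull hxs⟩

variable [FiniteDimensional ℝ E]

theorem card_le_dim_add_one (hs : AffineIndependent ℝ ((↑) : s → E)) (hsP : (s : Set E) ⊆ P) :
    #s ≤ dim P + 1 := by
  have h := hs.card_le_finrank_succ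
  rw [Subtype.range_coe_subtype, Fintype.card_coe] at h
  exact h.trans (Nat.add_le_add_right (Submodule.finrank_mono (vectorSpan_mono ℝ hsP)) 1)

/-- A simplex of full dimension spans the affine hull. -/
theorem subset_affineSpan_of_card (hs : AffineIndependent ℝ ((↑) : s → E)) (hsP : (s : Set E) ⊆ P)
    (hcard : #s = dim P + 1) : P ⊆ affineSpan ℝ (s : Set E) := by
  have h := hs.affineSpan_eq_of_le_of_card_eq_finrank_add_one (sp := affineSpan ℝ P) ?_ ?_
  · rw [Subtype.range_coe_subtype] at h
    rw [show ((s : Set E)) = {x | x ∈ s} from rfl, h]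
    exact subset_affineSpan ℝ P
  · rw [Subtype.range_coe_subtype]
    exact affineSpan_mono ℝ hsP
  · rw [Fintype.card_coe, hcard, direction_affineSpan, dim]

theorem not_subset_affineSpan_of_card (hs : s.Nonempty) (hcard : #s ≤ dim P) :
    ¬ P ⊆ affineSpan ℝ (s : Set E) := by
  intro h
  have h1 : vectorSpan ℝ P ≤ vectorSpan ℝ (s : Set E) := by
    rw [← direction_affineSpan, ← direction_affineSpan]
    exact AffineSubspace.direction_le (affineSpan_le.2 h)
  have h2 := Submodule.finrank_mono h1
  obtain ⟨n, hn⟩ := Nat.exists_eq_succ_of_ne_zero hs.card_pos.ne'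
  have h4 := finrank_vectorSpan_range_le (k := ℝ) (p := ((↑) : s → E)) (n := n)
    (by rw [Fintype.card_coe, hn])
  rw [Subtype.range_coe_subtype] at h4
  have h5 : Module.finrank ℝ (vectorSpan ℝ (s : Set E)) ≤ n := h4
  rw [dim] at hcard
  omega

theorem continuous_coord (s : Finset E) (w : E) : Continuous (coord s w) :=
  (coord s w).continuous_of_finiteDimensional

end Complexes

/-! ### Decomposition of a triangulation into intervals -/

section Partition

open Finset Geometry Filter Topology

variable {K : SimplicialComplex ℝ E} {s t : Finset E} {x y q v w : E} {P F : Set E}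

/-- A vertex of a polytope is a face. -/
theorem isFace_singleton (hP : IsPolytope P) (hv : v ∈ P.extremePoints ℝ) : IsFace P {v} := by
  have h : carrier P v = {v} := by
    refine Set.Subset.antisymm (fun y hy => ?_) (Set.singleton_subset_iff.2 mem_carrier)
    obtain ⟨ε, hε, hmem⟩ := exists_prolong_carrier hP hv.1 hy
    exact hv.2 ((isFace_carrier hP hv.1).subset hy) hmem (mem_openSegment_prolong v y hε)
  exact h ▸ isFace_carrier hP hv.1

theorem right_mem_of_lineMap_mem {A : AffineSubspace ℝ E} {ε : ℝ} (hε : ε ≠ 0) (hx : x ∈ A)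
    (h : AffineMap.lineMap x y ε ∈ A) : y ∈ A := by
  have := AffineMap.lineMap_mem ε⁻¹ hx h
  rwa [AffineMap.lineMap_lineMap_right, inv_mul_cancel₀ hε, AffineMap.lineMap_apply_one] at this

theorem lineMap_mem_of_convex (hP : Convex ℝ P) (hx : x ∈ P) (hy : y ∈ P) {ε : ℝ} (h0 : 0 ≤ ε)
    (h1 : ε ≤ 1) : AffineMap.lineMap x y ε ∈ P :=
  hP.segment_subset hx hy (segment_eq_image_lineMap ℝ x y ▸ ⟨ε, ⟨h0, h1⟩, rfl⟩)

theorem eventually_mem_Ioo_zero_one : ∀ᶠ ε : ℝ in 𝓝[>] 0, ε ∈ Set.Ioo (0 : ℝ) 1 :=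
  Ioo_mem_nhdsGT one_pos

theorem tendsto_lineMap_nhdsGT (x y : E) :
    Tendsto (fun ε : ℝ => AffineMap.lineMap x y ε) (𝓝[>] 0) (𝓝 x) := by
  have h : Tendsto (fun ε : ℝ => AffineMap.lineMap x y ε) (𝓝 0)
      (𝓝 (AffineMap.lineMap x y (0 : ℝ))) :=
    (AffineMap.lineMap_continuous (R := ℝ)).tendsto 0
  rw [AffineMap.lineMap_apply_zero] at h
  exact h.mono_left nhdsWithin_le_nhds

/-- Points of a convex set that avoid finitely many affine subspaces, none of which contains the
set, can be found arbitrarily close to any of its points. -/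
theorem exists_mem_forall_notMem [FiniteDimensional ℝ E] (hP : Convex ℝ P) (hv : v ∈ P)
    (𝒜 : Finset (Finset E)) (h𝒜 : ∀ s ∈ 𝒜, ¬ P ⊆ affineSpan ℝ (s : Set E)) {U : Set E}
    (hU : U ∈ 𝓝 v) : ∃ q ∈ P, q ∈ U ∧ ∀ s ∈ 𝒜, q ∉ affineSpan ℝ (s : Set E) := by
  classical
  induction 𝒜 using Finset.induction_on generalizing U with
  | empty => exact ⟨v, hv, mem_of_mem_nhds hU, by simp⟩
  | insert t 𝒜 _ ih =>
    obtain ⟨q, hq, hqU, hq𝒜⟩ := ih (fun s hs => h𝒜 s (mem_insert_of_mem hs))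
      (interior_mem_nhds.2 hU)
    by_cases hqt : q ∈ affineSpan ℝ (t : Set E)
    · obtain ⟨y, hy, hyt⟩ := Set.not_subset.1 (h𝒜 t (mem_insert_self _ _))
      have h1 : ∀ᶠ ε : ℝ in 𝓝[>] 0, AffineMap.lineMap q y ε ∈ U :=
        tendsto_lineMap_nhdsGT q y (mem_interior_iff_mem_nhds.1 hqU)
      have h2 : ∀ᶠ ε : ℝ in 𝓝[>] 0, ∀ s ∈ 𝒜,
          AffineMap.lineMap q y ε ∉ affineSpan ℝ (s : Set E) := by
        rw [Filter.eventually_all_finset]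
        intro s hs
        have hcl : IsClosed (affineSpan ℝ (s : Set E) : Set E) :=
          AffineSubspace.closed_of_finiteDimensional _
        exact tendsto_lineMap_nhdsGT q y (hcl.isOpen_compl.mem_nhds (hq𝒜 s hs))
      obtain ⟨ε, hεU, hε𝒜, hε⟩ := (h1.and (h2.and eventually_mem_Ioo_zero_one)).exists
      refine ⟨_, lineMap_mem_of_convex hP hq hy hε.1.le hε.2.le, hεU, fun s hs => ?_⟩
      rcases Finset.mem_insert.1 hs with rfl | hs
      · exact fun h => hyt (right_mem_of_lineMap_mem hε.1.ne' hqt h)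
      · exact hε𝒜 s hs
    · refine ⟨q, hq, interior_subset hqU, fun s hs => ?_⟩
      rcases Finset.mem_insert.1 hs with rfl | hs
      exacts [hqt, hq𝒜 s hs]

/-- The germ at `x` of the segment from `x` to `q` lies in one simplex of the triangulation. -/
theorem IsTriangulation.exists_lineMap_mem (hP : Convex ℝ P) (hK : IsTriangulation P K)
    (hx : x ∈ P) (hq : q ∈ P) : ∃ T ∈ K.faces, x ∈ convexHull ℝ (T : Set E) ∧
      ∃ ε : ℝ, 0 < ε ∧ AffineMap.lineMap x q ε ∈ convexHull ℝ (T : Set E) := by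
  have h : ∃ T ∈ K.faces, ∃ᶠ ε : ℝ in 𝓝[>] 0,
      AffineMap.lineMap x q ε ∈ convexHull ℝ (T : Set E) := by
    by_contra! hcon
    obtain ⟨ε, hε, hε1⟩ :=
      (((Filter.eventually_all_finite hK.1).2 hcon).and eventually_mem_Ioo_zero_one).exists
    have := lineMap_mem_of_convex hP hx hq hε1.1.le hε1.2.le
    rw [← hK.2, SimplicialComplex.mem_space_iff] at this
    obtain ⟨T, hT, hTε⟩ := this
    exact hε T hT hTε
  obtain ⟨T, hT, hf⟩ := h
  have hcl : IsClosed (convexHull ℝ (T : Set E)) := (T.finite_toSet.isCompact_convexHull ℝ).isClosed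
  obtain ⟨ε, hε, hε1⟩ := (hf.and_eventually eventually_mem_Ioo_zero_one).exists
  exact ⟨T, hT, hcl.mem_of_frequently_of_tendsto hf (tendsto_lineMap_nhdsGT x q), ε, hε1.1, hε⟩

theorem affineMap_lineMap (f : E →ᵃ[ℝ] ℝ) (x y : E) (ε : ℝ) :
    f (AffineMap.lineMap x y ε) = (1 - ε) * f x + ε * f y := by
  rw [AffineMap.apply_lineMap, AffineMap.lineMap_apply_module, smul_eq_mul, smul_eq_mul]

/-- `q` lies in general position to the simplices of `K`: it is not in the span of a simplex of
dimension smaller than `dim P`. -/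
def IsGeneric (P : Set E) (K : SimplicialComplex ℝ E) (q : E) : Prop :=
  ∀ s ∈ K.faces, #s ≤ dim P → q ∉ affineSpan ℝ (s : Set E)

theorem IsGeneric.coord_ne_zero (hgen : IsGeneric P K q) {T : Finset E} (hT : T ∈ K.faces)
    (hcard : #T = dim P + 1) (hq : q ∈ affineSpan ℝ (T : Set E)) (hw : w ∈ T) :
    coord T w q ≠ 0 := by
  classical
  intro h0
  have hmem := mem_affineSpan_erase (K.indep hT) hq hw h0
  by_cases hne : (T.erase w).Nonempty
  · exact hgen _ (K.down_closed hT (Finset.erase_subset _ _) hne)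
      (by rw [Finset.card_erase_of_mem hw, hcard]; simp) hmem
  · rw [Finset.not_nonempty_iff_eq_empty.1 hne, Finset.coe_empty,
      AffineSubspace.span_empty] at hmem
    exact hmem

/-- The coordinates of `q` with respect to `T` are positive at all vertices outside `s`. If `s` is
a face of `T`, this says that one enters the interior of `T` when moving from the center of `s`
towards `q`. -/
def Enters (q : E) (s T : Finset E) : Prop := ∀ w ∈ T, w ∉ s → 0 < coord T w q

open Classical in
/-- The simplices of a finite complex, including the empty simplex. -/
def IsTriangulation.simplices (hK : IsTriangulation P K) : Finset (Finset E) :=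
  insert ∅ hK.1.toFinset

theorem IsTriangulation.mem_simplices (hK : IsTriangulation P K) :
    s ∈ hK.simplices ↔ s = ∅ ∨ s ∈ K.faces := by
  simp [simplices]

variable [FiniteDimensional ℝ E]

theorem IsTriangulation.exists_isGeneric (hP : Convex ℝ P) (hK : IsTriangulation P K) (hv : v ∈ P)
    {U : Set E} (hU : U ∈ 𝓝 v) : ∃ q ∈ P, q ∈ U ∧ IsGeneric P K q := by
  classical
  obtain ⟨q, hq, hqU, h⟩ := exists_mem_forall_notMem hP hv
    (hK.1.toFinset.filter fun s => #s ≤ dim P) (fun s hs => by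
      obtain ⟨hs, hcard⟩ := Finset.mem_filter.1 hs
      exact not_subset_affineSpan_of_card
        (K.nonempty_of_mem_faces (hK.1.mem_toFinset.1 hs)) hcard) hU
  exact ⟨q, hq, hqU, fun s hs hcard =>
    h s (Finset.mem_filter.2 ⟨hK.1.mem_toFinset.2 hs, hcard⟩)⟩

/-- Given a generic point `q` of `P`, every simplex `s` of the triangulation, including the empty
one, lies in exactly one full-dimensional simplex `T` in which the coordinates of `q` at the
vertices outside `s` are positive: the simplex that is entered when one moves from the center of
`s` towards `q`. -/
theorem IsTriangulation.existsUnique_facet (hP : Convex ℝ P) (hK : IsTriangulation P K)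
    (hq : q ∈ P) (hgen : IsGeneric P K q) (hs : s = ∅ ∨ s ∈ K.faces) :
    ∃! T, T ∈ K.faces ∧ #T = dim P + 1 ∧ s ⊆ T ∧ Enters q s T := by
  -- The segment towards `q` starts at the center of `s`, and is constant if `s` is empty.
  have hx : ∃ x ∈ P, (∀ T ∈ K.faces, x ∈ convexHull ℝ (T : Set E) → s ⊆ T) ∧
      ∀ T ∈ K.faces, s ⊆ T → ∀ w ∈ T,
        (w ∈ s → 0 < coord T w x) ∧ (w ∉ s → coord T w x = 0 ∨ x = q) := by
    rcases hs with rfl | hs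
    · exact ⟨q, hq, by simp, by simp⟩
    · have hc := center_mem_openSimplex (K.nonempty_of_mem_faces hs)
      refine ⟨center s, hK.convexHull_subset hs (openSimplex_subset_convexHull hc),
        fun T hT hcT => subset_of_mem_openSimplex hs hT hc hcT, fun T hT hsT w hw => ?_⟩
      have := coord_of_mem_openSimplex_subset (K.indep hT) hsT hc hw
      exact ⟨this.1, fun h => Or.inl (this.2 h)⟩
  obtain ⟨x, hxP, hxs, hxc⟩ := hx
  obtain ⟨T, hT, hxT, ε, hε, hεT⟩ := hK.exists_lineMap_mem hP hxP hq
  have hqT : q ∈ affineSpan ℝ (T : Set E) := right_mem_of_lineMap_mem hε.ne'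
    (convexHull_subset_affineSpan _ hxT) (convexHull_subset_affineSpan _ hεT)
  have hcard : #T = dim P + 1 :=
    le_antisymm (card_le_dim_add_one (K.indep hT) (hK.subset hT))
      (not_le.1 fun hle => hgen T hT hle hqT)
  have hTall : T ∈ K.faces ∧ #T = dim P + 1 ∧ s ⊆ T ∧ Enters q s T := by
    refine ⟨hT, hcard, hxs T hT hxT, fun w hw hws => ?_⟩
    refine lt_of_le_of_ne ?_ (hgen.coord_ne_zero hT hcard hqT hw).symm
    have h1 := ((mem_convexHull_iff_coord (K.indep hT)).1 hεT).2 w hw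
    rw [affineMap_lineMap] at h1
    rcases (hxc T hT (hxs T hT hxT) w hw).2 hws with h0 | rfl
    · rw [h0, mul_zero, zero_add] at h1
      exact nonneg_of_mul_nonneg_right h1 hε
    · exact ((mem_convexHull_iff_coord (K.indep hT)).1 hxT).2 w hw
  refine ⟨T, hTall, ?_⟩
  -- Near `x`, the segment towards `q` runs in the relative interior of such a simplex.
  have hev : ∀ T', (T' ∈ K.faces ∧ #T' = dim P + 1 ∧ s ⊆ T' ∧ Enters q s T') →
      ∀ᶠ ε : ℝ in 𝓝[>] 0, AffineMap.lineMap x q ε ∈ openSimplex T' := by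
    rintro T' ⟨hT', hcard', hsT', hpos⟩
    have hspan := subset_affineSpan_of_card (K.indep hT') (hK.subset hT') hcard'
    have h1 : ∀ᶠ ε : ℝ in 𝓝[>] 0, ∀ w ∈ T', 0 < coord T' w (AffineMap.lineMap x q ε) := by
      rw [Filter.eventually_all_finset]
      intro w hw
      by_cases hws : w ∈ s
      · exact (((continuous_coord T' w).tendsto x).comp (tendsto_lineMap_nhdsGT x q))
          (lt_mem_nhds ((hxc T' hT' hsT' w hw).1 hws))
      · filter_upwards [eventually_mem_Ioo_zero_one] with ε hε
        rw [affineMap_lineMap]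
        have hq0 := hpos w hw hws
        rcases (hxc T' hT' hsT' w hw).2 hws with h0 | rfl
        · rw [h0, mul_zero, zero_add]
          exact mul_pos hε.1 hq0
        · linarith [show (1 - ε) * coord T' w x + ε * coord T' w x = coord T' w x by ring]
    filter_upwards [h1] with ε hε
    exact mem_openSimplex_of_coord (K.indep hT')
      (AffineMap.lineMap_mem ε (hspan hxP) (hspan hq)) hε
  intro T' hT'
  obtain ⟨ε, h1, h2⟩ := ((hev T' hT').and (hev T hTall)).exists
  exact eq_of_mem_openSimplex hT'.1 hT h1 h2

/-- A triangulation of a convex set is pure. -/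
theorem IsTriangulation.exists_facet (hP : Convex ℝ P) (hK : IsTriangulation P K)
    (hs : s ∈ K.faces) : ∃ T ∈ K.faces, #T = dim P + 1 ∧ s ⊆ T := by
  obtain ⟨w, hw⟩ := K.nonempty_of_mem_faces hs
  obtain ⟨q, hq, -, hgen⟩ := hK.exists_isGeneric hP (hK.subset hs hw) univ_mem
  obtain ⟨T, ⟨hT, hcard, hsT, -⟩, -⟩ := hK.existsUnique_facet hP hq hgen (Or.inr hs)
  exact ⟨T, hT, hcard, hsT⟩

open Classical in
/-- A sum over the simplices, split along the intervals attached to the full-dimensional simplices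
by a generic point. -/
theorem IsTriangulation.sum_simplices (hP : Convex ℝ P) (hK : IsTriangulation P K)
    (hq : q ∈ P) (hgen : IsGeneric P K q) (φ : ℕ → ℤ) :
    ∑ s ∈ hK.simplices, φ #s = ∑ T ∈ hK.1.toFinset with #T = dim P + 1,
      ∑ u ∈ (T.filter fun w => 0 < coord T w q).powerset, φ (dim P + 1 - #u) := by
  have h1 : ∑ s ∈ hK.simplices, φ #s = ∑ s ∈ hK.simplices,
      ∑ T ∈ hK.1.toFinset with (#T = dim P + 1 ∧ s ⊆ T ∧ Enters q s T),
        φ #s := by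
    refine Finset.sum_congr rfl fun s hs => ?_
    obtain ⟨T, hT, huniq⟩ := hK.existsUnique_facet hP hq hgen (hK.mem_simplices.1 hs)
    have : hK.1.toFinset.filter (fun T => #T = dim P + 1 ∧ s ⊆ T ∧ Enters q s T) = {T} := by
      ext T'
      rw [Finset.mem_filter, hK.1.mem_toFinset, Finset.mem_singleton]
      exact ⟨huniq T', fun h => h ▸ hT⟩
    rw [this, Finset.sum_singleton]
  rw [h1, Finset.sum_comm' (t' := hK.1.toFinset.filter fun T => #T = dim P + 1)
    (s' := fun T => T.powerset.filter fun s => Enters q s T)]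
  · refine Finset.sum_congr rfl fun T hT => ?_
    obtain ⟨hT, hcard⟩ := Finset.mem_filter.1 hT
    refine Finset.sum_nbij' (fun s => T \ s) (fun u => T \ u) (fun s hs => ?_) (fun u hu => ?_)
      (fun s hs => ?_) (fun u hu => ?_) fun s hs => ?_
    · obtain ⟨hs, hpos⟩ := Finset.mem_filter.1 hs
      refine Finset.mem_powerset.2 fun w hw => Finset.mem_filter.2 ?_
      obtain ⟨hwT, hws⟩ := Finset.mem_sdiff.1 hw
      exact ⟨hwT, hpos w hwT hws⟩
    · refine Finset.mem_filter.2 ⟨Finset.mem_powerset.2 Finset.sdiff_subset, fun w hw hwu => ?_⟩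
      have : w ∈ u := by simpa [hw] using hwu
      exact (Finset.mem_filter.1 (Finset.mem_powerset.1 hu this)).2
    · exact Finset.sdiff_sdiff_eq_self (Finset.mem_powerset.1 (Finset.mem_filter.1 hs).1)
    · exact Finset.sdiff_sdiff_eq_self
        ((Finset.mem_powerset.1 hu).trans (Finset.filter_subset _ _))
    · have hsT := Finset.mem_powerset.1 (Finset.mem_filter.1 hs).1
      have := Finset.card_le_card hsT
      rw [Finset.card_sdiff_of_subset hsT, hcard]
      congr 1
      omega
  · intro s T
    simp only [Finset.mem_filter, hK.mem_simplices, Set.Finite.mem_toFinset, Finset.mem_powerset]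
    constructor
    · rintro ⟨-, hT, hcard, hsT, hpos⟩
      exact ⟨⟨hsT, hpos⟩, hT, hcard⟩
    · rintro ⟨⟨hsT, hpos⟩, hT, hcard⟩
      refine ⟨?_, hT, hcard, hsT, hpos⟩
      rcases s.eq_empty_or_nonempty with h | h
      exacts [Or.inl h, Or.inr (K.down_closed hT hsT h)]

theorem sum_powerset_neg_one_pow_mul_card {α : Type*} [DecidableEq α] {U : Finset α}
    (hU : 2 ≤ #U) : ∑ u ∈ U.powerset, (-1 : ℤ) ^ #u * (#u : ℤ) = 0 := by
  obtain ⟨a, ha⟩ := Finset.card_pos.1 (by omega : 0 < #U)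
  have hne : (U.erase a).Nonempty := by
    rw [← Finset.card_pos, Finset.card_erase_of_mem ha]
    omega
  rw [← Finset.insert_erase ha, Finset.sum_powerset_insert (Finset.notMem_erase a U),
    ← Finset.sum_add_distrib, ← neg_zero,
    ← Finset.sum_powerset_neg_one_pow_card_of_nonempty hne, ← Finset.sum_neg_distrib]
  refine Finset.sum_congr rfl fun u hu => ?_
  have hau : a ∉ u := fun h => Finset.notMem_erase a U (Finset.mem_powerset.1 hu h)
  rw [Finset.card_insert_of_notMem hau]
  push_cast
  ring

/-- If all full-dimensional simplices share a vertex `v` of the polytope, then the two alternating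
sums that define the last two entries of the `h`-vector vanish. With a generic point near `v`,
every interval of the decomposition has rank at least two. -/
theorem IsTriangulation.alternating_sums (hP : IsPolytope P) (hK : IsTriangulation P K)
    (hd : 1 ≤ dim P) (hv : v ∈ P.extremePoints ℝ)
    (hvT : ∀ T ∈ K.faces, #T = dim P + 1 → v ∈ T) :
    ∑ s ∈ hK.simplices, (-1 : ℤ) ^ #s = 0 ∧
      ∑ s ∈ hK.simplices, (-1 : ℤ) ^ #s * (#s : ℤ) = 0 := by
  classical
  have hU : ∀ᶠ q in 𝓝 v, ∀ T ∈ hK.1.toFinset, #T = dim P + 1 → 0 < coord T v q := by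
    rw [Filter.eventually_all_finset]
    intro T hT
    by_cases hcard : #T = dim P + 1
    · have hT' := hK.1.mem_toFinset.1 hT
      have h1 : 0 < coord T v v := by rw [coord_self (K.indep hT') (hvT T hT' hcard)]; exact one_pos
      filter_upwards [(continuous_coord T v).tendsto v (lt_mem_nhds h1)] with q hq _
      exact hq
    · exact Filter.Eventually.of_forall fun q h => absurd h hcard
  obtain ⟨q, hq, hqU, hgen⟩ := hK.exists_isGeneric hP.convex hv.1 hU
  have hcard2 : ∀ T ∈ hK.1.toFinset, #T = dim P + 1 →
      2 ≤ #(T.filter fun w => 0 < coord T w q) := by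
    intro T hT hcard
    have hT' := hK.1.mem_toFinset.1 hT
    have hvmem := hvT T hT' hcard
    by_contra! hlt
    have hneg : ∀ w ∈ T, w ≠ v → coord T w q ≤ 0 := by
      intro w hw hne
      by_contra! hpos
      refine absurd hlt (not_lt.2 (Finset.one_lt_card.2 ⟨w, ?_, v, ?_, hne⟩))
      · exact Finset.mem_filter.2 ⟨hw, hpos⟩
      · exact Finset.mem_filter.2 ⟨hvmem, hqU T hT hcard⟩
    -- A functional that exposes `v` is too large at `q` if only the coordinate at `v` is positive.
    obtain ⟨l, m, hl1, hl2, hl3⟩ := (isFace_singleton hP hv).exists_functional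
    obtain ⟨h1, h2⟩ := sum_coord (K.indep hT')
      (subset_affineSpan_of_card (K.indep hT') (hK.subset hT') hcard hq)
    have hqv : q ≠ v := by
      rintro rfl
      refine hgen {q} (K.down_closed hT' (Finset.singleton_subset_iff.2 hvmem)
        (Finset.singleton_nonempty _)) (by simpa using hd) ?_
      simp
    have h3 : l q - m = ∑ w ∈ T, coord T w q * (l w - m) := by
      simp only [mul_sub, Finset.sum_sub_distrib, ← Finset.sum_mul, h1, one_mul]
      congr 1
      conv_lhs => rw [← h2]
      simp
    have h4 : 0 ≤ l q - m := by
      rw [h3]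
      refine Finset.sum_nonneg fun w hw => ?_
      by_cases hwv : w = v
      · simp [hwv, hl1 v rfl]
      · exact mul_nonneg_of_nonpos_of_nonpos (hneg w hw hwv)
          (sub_nonpos.2 (hl2 w (hK.subset hT' hw)))
    linarith [hl3 q hq hqv]
  have hsum1 : ∀ T ∈ hK.1.toFinset.filter fun T => #T = dim P + 1,
      ∑ u ∈ (T.filter fun w => 0 < coord T w q).powerset, (-1 : ℤ) ^ #u = 0 := fun T hT => by
    obtain ⟨hT, hcard⟩ := Finset.mem_filter.1 hT
    exact Finset.sum_powerset_neg_one_pow_card_of_nonempty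
      (Finset.card_pos.1 (by have := hcard2 T hT hcard; omega))
  have hsign : ∀ T ∈ hK.1.toFinset.filter fun T => #T = dim P + 1,
      ∀ u ∈ (T.filter fun w => 0 < coord T w q).powerset,
        #u ≤ dim P + 1 ∧ (-1 : ℤ) ^ (dim P + 1 - #u) = (-1) ^ (dim P + 1) * (-1) ^ #u := by
    intro T hT u hu
    have hle : #u ≤ dim P + 1 := by
      rw [← (Finset.mem_filter.1 hT).2]
      exact Finset.card_le_card ((Finset.mem_powerset.1 hu).trans (Finset.filter_subset _ _))
    refine ⟨hle, ?_⟩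
    obtain ⟨k, hk⟩ := Nat.exists_eq_add_of_le hle
    rw [hk, Nat.add_sub_cancel_left, pow_add, mul_right_comm, ← mul_pow]
    simp
  constructor
  · rw [hK.sum_simplices hP.convex hq hgen fun k => (-1) ^ k]
    refine Finset.sum_eq_zero fun T hT => ?_
    rw [Finset.sum_congr rfl fun u hu => (hsign T hT u hu).2, ← Finset.mul_sum, hsum1 T hT,
      mul_zero]
  · rw [hK.sum_simplices hP.convex hq hgen fun k => (-1) ^ k * (k : ℤ)]
    refine Finset.sum_eq_zero fun T hT => ?_
    have h1 : ∀ u ∈ (T.filter fun w => 0 < coord T w q).powerset,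
        (-1 : ℤ) ^ (dim P + 1 - #u) * ((dim P + 1 - #u : ℕ) : ℤ) =
        (-1) ^ (dim P + 1) * (dim P + 1) * (-1) ^ #u -
          (-1) ^ (dim P + 1) * ((-1) ^ #u * (#u : ℤ)) := fun u hu => by
      rw [(hsign T hT u hu).2, Nat.cast_sub (hsign T hT u hu).1]
      push_cast
      ring
    obtain ⟨hT1, hcard⟩ := Finset.mem_filter.1 hT
    rw [Finset.sum_congr rfl h1, Finset.sum_sub_distrib, ← Finset.mul_sum, ← Finset.mul_sum,
      hsum1 T hT, sum_powerset_neg_one_pow_mul_card (hcard2 T hT1 hcard)]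
    simp

end Partition

/-! ### Polytope numbers in terms of the simplices of a pointed triangulation -/

section Numbers

open Finset Geometry

variable {K : SimplicialComplex ℝ E} {s t : Finset E} {x y a : E} {P F : Set E} {v : Set E → E}

/-- The faces of a face of a polytope are the faces of the polytope inside it. -/
theorem IsFace.isFace_iff {G : Set E} (hP : IsPolytope P) (hF : IsFace P F) :
    IsFace F G ↔ IsFace P G ∧ G ⊆ F :=
  ⟨fun h => ⟨hF.trans hP h, h.subset⟩, fun h => h.1.mono h.2 hF.subset⟩

/-- The smallest face of `P` that contains the simplex `s`. -/
def simplexCarrier (P : Set E) (s : Finset E) : Set E := carrier P (center s)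

theorem center_mem_of_subset (hP : Convex ℝ P) (hsP : (s : Set E) ⊆ P) (hs : s.Nonempty) :
    center s ∈ P :=
  convexHull_min hsP hP (openSimplex_subset_convexHull (center_mem_openSimplex hs))

theorem isFace_simplexCarrier (hP : IsPolytope P) (hsP : (s : Set E) ⊆ P) (hs : s.Nonempty) :
    IsFace P (simplexCarrier P s) :=
  isFace_carrier hP (center_mem_of_subset hP.convex hsP hs)

theorem simplexCarrier_subset_iff (hP : Convex ℝ P) (hsP : (s : Set E) ⊆ P) (hs : s.Nonempty)
    (hF : IsFace P F) : simplexCarrier P s ⊆ F ↔ (s : Set E) ⊆ F := by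
  rw [simplexCarrier, carrier_subset_iff hF]
  exact ⟨fun h => (subset_convexHull ℝ _).trans
    (hF.convexHull_subset hP hsP (center_mem_openSimplex hs) h),
    fun h => center_mem_of_subset (hF.1.convex hP) h hs⟩

theorem IsTriangulation.isFace_simplexCarrier (hP : IsPolytope P) (hK : IsTriangulation P K)
    (hs : s ∈ K.faces) : IsFace P (simplexCarrier P s) :=
  PolytopeNumbers.isFace_simplexCarrier hP (hK.subset hs) (K.nonempty_of_mem_faces hs)

theorem IsTriangulation.simplexCarrier_subset_iff (hP : Convex ℝ P) (hK : IsTriangulation P K)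
    (hs : s ∈ K.faces) (hF : IsFace P F) :
    simplexCarrier P s ⊆ F ↔ convexHull ℝ (s : Set E) ⊆ F := by
  rw [PolytopeNumbers.simplexCarrier_subset_iff hP (hK.subset hs) (K.nonempty_of_mem_faces hs) hF,
    (hF.1.convex hP).convexHull_subset_iff]

open Classical in
/-- Summing over a finite family of faces the sums over the simplices in their relative
interiors. -/
theorem finsum_simplexCarrier (hP : IsPolytope P) (𝒦 : Finset (Finset E)) (φ : Finset E → ℤ)
    {Q : Set E → Prop} [DecidablePred fun s : Finset E => Q (simplexCarrier P s)]
    (hQ : ∀ G, Q G → IsFace P G) :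
    ∑ᶠ G : {G // Q G}, ∑ s ∈ 𝒦 with simplexCarrier P s = G.1, φ s =
      ∑ s ∈ 𝒦 with Q (simplexCarrier P s), φ s := by
  have hfin : {G | Q G}.Finite := hP.finite_faces.subset hQ
  have : Fintype {G // Q G} := hfin.fintype
  rw [finsum_eq_sum_of_fintype]
  simp only [Finset.sum_filter]
  rw [Finset.sum_comm]
  refine Finset.sum_congr rfl fun s _ => ?_
  by_cases h : Q (simplexCarrier P s)
  · rw [if_pos h, Finset.sum_eq_single_of_mem (⟨_, h⟩ : {G // Q G}) (Finset.mem_univ _)]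
    · simp
    · intro G _ hG
      exact if_neg fun h' => hG (Subtype.ext h'.symm)
  · rw [if_neg h]
    exact Finset.sum_eq_zero fun G _ => if_neg fun h' : simplexCarrier P s = G.1 => h (h' ▸ G.2)

variable [FiniteDimensional ℝ E]

theorem IsTriangulation.insert_mem_faces [DecidableEq E] (hP : Convex ℝ P)
    (hK : IsTriangulation P K) (haT : ∀ T ∈ K.faces, #T = dim P + 1 → a ∈ T) (hs : s ∈ K.faces) :
    insert a s ∈ K.faces := by
  obtain ⟨T, hT, hcard, hsT⟩ := hK.exists_facet hP hs
  exact K.down_closed hT (Finset.insert_subset (haT T hT hcard) hsT) (Finset.insert_nonempty _ _)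

/-- If `a` lies in all full-dimensional simplices, then a simplex without the vertex `a` lies in a
face of the polytope that does not contain `a`. Otherwise, the segment from `a` to the center of
the simplex could be prolonged inside the polytope, into a simplex with a negative coordinate
at `a`. -/
theorem IsTriangulation.exists_face_notMem (hP : IsPolytope P) (hK : IsTriangulation P K)
    (haT : ∀ T ∈ K.faces, #T = dim P + 1 → a ∈ T) (hs : s ∈ K.faces) (has : a ∉ s) :
    ∃ F, IsFace P F ∧ a ∉ F ∧ convexHull ℝ (s : Set E) ⊆ F := by
  by_contra! hcon
  have hc := center_mem_openSimplex (K.nonempty_of_mem_faces hs)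
  have hcP := hK.convexHull_subset hs (openSimplex_subset_convexHull hc)
  obtain ⟨ε, hε, hmem⟩ := hP.exists_prolong (y := a) hcP fun F hF hcF => by
    by_contra haF
    exact hcon F hF haF (hF.convexHull_subset hP.convex (hK.subset hs) hc hcF)
  obtain ⟨T, hT, hcT, δ, hδ, hδT⟩ := hK.exists_lineMap_mem hP.convex hcP hmem
  obtain ⟨T', hT', hcard, hTT'⟩ := hK.exists_facet hP.convex hT
  have haT' := haT T' hT' hcard
  have hsT' := (subset_of_mem_openSimplex hs hT hc hcT).trans hTT'
  have h1 := ((mem_convexHull_iff_coord (K.indep hT')).1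
    (convexHull_mono (Finset.coe_subset.2 hTT') hδT)).2 a haT'
  have h2 : center s + ε • (center s - a) = AffineMap.lineMap a (center s) (1 + ε) := by
    rw [AffineMap.lineMap_apply_module']
    module
  rw [affineMap_lineMap, h2, affineMap_lineMap, coord_self (K.indep hT') haT',
    (coord_of_mem_openSimplex_subset (K.indep hT') hsT' hc haT').2 has] at h1
  nlinarith [mul_pos hδ hε]

/-- A complex in which all full-dimensional simplices contain `a` is a cone with apex `a`. -/
theorem IsTriangulation.sum_cone [DecidableEq E] (hP : Convex ℝ P) (hK : IsTriangulation P K)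
    (haT : ∀ T ∈ K.faces, #T = dim P + 1 → a ∈ T) (haP : a ∈ P) (φ : ℕ → ℤ) :
    ∑ s ∈ hK.1.toFinset, φ #s =
      φ 1 + ∑ s ∈ hK.1.toFinset with a ∉ s, (φ #s + φ (#s + 1)) := by
  have ha : {a} ∈ K.faces := by
    obtain ⟨s, hs, -⟩ := SimplicialComplex.mem_space_iff.1 (hK.2.symm ▸ haP)
    exact K.down_closed (hK.insert_mem_faces hP haT hs)
      (Finset.singleton_subset_iff.2 (Finset.mem_insert_self _ _)) (Finset.singleton_nonempty _)
  have h0 : (∅ : Finset E) ∉ hK.1.toFinset.filter fun s => a ∉ s := fun h =>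
    K.empty_notMem (hK.1.mem_toFinset.1 (Finset.mem_filter.1 h).1)
  have h1 : ∑ s ∈ hK.1.toFinset with a ∈ s, φ #s =
      ∑ s ∈ insert ∅ (hK.1.toFinset.filter fun s => a ∉ s), φ (#s + 1) := by
    refine Finset.sum_nbij' (fun s => s.erase a) (fun s => insert a s) (fun s hs => ?_)
      (fun s hs => ?_) (fun s hs => ?_) (fun s hs => ?_) fun s hs => ?_
    · obtain ⟨hs, has⟩ := Finset.mem_filter.1 hs
      rcases (s.erase a).eq_empty_or_nonempty with h | h
      · rw [h]
        exact Finset.mem_insert_self _ _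
      · refine Finset.mem_insert_of_mem (Finset.mem_filter.2 ⟨?_, Finset.notMem_erase _ _⟩)
        exact hK.1.mem_toFinset.2
          (K.down_closed (hK.1.mem_toFinset.1 hs) (Finset.erase_subset _ _) h)
    · refine Finset.mem_filter.2 ⟨hK.1.mem_toFinset.2 ?_, Finset.mem_insert_self _ _⟩
      rcases Finset.mem_insert.1 hs with rfl | hs
      · exact ha
      · exact hK.insert_mem_faces hP haT (hK.1.mem_toFinset.1 (Finset.mem_filter.1 hs).1)
    · exact Finset.insert_erase (Finset.mem_filter.1 hs).2
    · refine Finset.erase_insert ?_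
      rcases Finset.mem_insert.1 hs with rfl | hs
      exacts [Finset.notMem_empty a, (Finset.mem_filter.1 hs).2]
    · rw [Finset.card_erase_add_one (Finset.mem_filter.1 hs).2]
  rw [← Finset.sum_filter_add_sum_filter_not _ fun s => a ∈ s, h1, Finset.sum_insert h0,
    Finset.sum_add_distrib, Finset.card_empty]
  ring

theorem exists_eq_singleton_of_dim_eq_zero (h : dim F = 0) (hF : F.Nonempty) : ∃ p, F = {p} := by
  rw [dim, Submodule.finrank_eq_zero, vectorSpan_eq_bot_iff_subsingleton] at h
  exact (Set.exists_eq_singleton_iff_nonempty_subsingleton).2 ⟨hF, h⟩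

open Classical in
/-- The polytope number `F(n + 2)` of a face counts the simplices of the triangulation inside `F`,
and the interior polytope number those in the relative interior of `F`, where a simplex with `i`
vertices is counted with the weight `n.choose (i - 1)`. -/
theorem IsPointedTriangulation.numbers_eq (hP : IsPolytope P)
    (hK : IsPointedTriangulation P K v) (hF : IsFace P F) (n : ℕ) :
    polytopeNumber v F (n + 2) = ∑ s ∈ hK.isTriangulation.1.toFinset with
        convexHull ℝ ((s : Finset E) : Set E) ⊆ F, (n.choose (#s - 1) : ℤ) ∧
      interiorNumber v F (n + 2) = ∑ s ∈ hK.isTriangulation.1.toFinset with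
        simplexCarrier P s = F, (n.choose (#s - 1) : ℤ) := by
  have hT := hK.isTriangulation
  have hconv := hP.convex
  induction hdim : dim F using Nat.strong_induction_on generalizing F n with
  | _ k ih =>
  subst hdim
  have hTF := hK.isTriangulation_face F hF
  have hTF_eq : hTF.1.toFinset =
      hT.1.toFinset.filter fun s : Finset E => convexHull ℝ (s : Set E) ⊆ F := by
    ext s
    simp [restrict]
  by_cases hd : dim F = 0
  · obtain ⟨p, rfl⟩ := exists_eq_singleton_of_dim_eq_zero hd hF.2
    have hsub : ∀ s ∈ K.faces, convexHull ℝ (s : Set E) ⊆ {p} → s = {p} := fun s hs h => by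
      refine (Finset.subset_singleton_iff.1 fun e he => Finset.mem_singleton.2
        (h (subset_convexHull ℝ _ he))).resolve_left (K.nonempty_of_mem_faces hs).ne_empty
    have hp : {p} ∈ K.faces ∧ convexHull ℝ (({p} : Finset E) : Set E) ⊆ {p} := by
      obtain ⟨s, hs, -⟩ := SimplicialComplex.mem_space_iff.1
        (hTF.2.symm ▸ Set.mem_singleton p)
      exact hsub s hs.1 hs.2 ▸ hs
    have hcar : simplexCarrier P {p} = {p} := by
      have h := (hT.simplexCarrier_subset_iff hconv hp.1 hF).2 hp.2
      exact (Set.subset_singleton_iff_eq.1 h).resolve_left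
        (hT.isFace_simplexCarrier hP hp.1).2.ne_empty
    have h1 : (hT.1.toFinset.filter fun s : Finset E => convexHull ℝ (s : Set E) ⊆ {p}) =
        {{p}} := by
      ext s
      rw [Finset.mem_filter, hT.1.mem_toFinset, Finset.mem_singleton]
      exact ⟨fun h => hsub s h.1 h.2, fun h => h ▸ hp⟩
    have h2 : (hT.1.toFinset.filter fun s => simplexCarrier P s = {p}) = {{p}} := by
      ext s
      rw [Finset.mem_filter, hT.1.mem_toFinset, Finset.mem_singleton]
      exact ⟨fun h => hsub s h.1 ((hT.simplexCarrier_subset_iff hconv h.1 hF).1 h.2.subset),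
        fun h => h ▸ ⟨hp.1, hcar⟩⟩
    rw [h1, h2, polytopeNumber, interiorNumber, if_pos hd, if_pos hd]
    simp
  have hFpoly := hF.isPolytope hP
  have hvF := hK.apex_mem_vertices F hF
  have hvT := hK.apex_mem_simplex F hF
  -- The simplices counted by the recursion are those that avoid the apex.
  have hrec : ∀ n : ℕ, ∑ᶠ G : {G : Set E // IsProperFace F G ∧ v F ∉ G},
      interiorNumber v G.1 (n + 2) =
      ∑ s ∈ hTF.1.toFinset with v F ∉ s, (n.choose (#s - 1) : ℤ) := by
    intro n
    have h1 : ∀ G : {G : Set E // IsProperFace F G ∧ v F ∉ G}, interiorNumber v G.1 (n + 2) =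
        ∑ s ∈ hT.1.toFinset with simplexCarrier P s = G.1, (n.choose (#s - 1) : ℤ) := fun G =>
      (ih _ G.2.1.dim_lt (hF.trans hP G.2.1.1) n rfl).2
    rw [finsum_congr h1, finsum_simplexCarrier hP (Q := fun G => IsProperFace F G ∧ v F ∉ G)
      _ _ fun G hG => hF.trans hP hG.1.1, hTF_eq, Finset.filter_filter]
    refine Finset.sum_congr ?_ fun _ _ => rfl
    ext s
    rw [Finset.mem_filter, Finset.mem_filter]
    refine and_congr_right fun hs => ?_
    have hs' := hT.1.mem_toFinset.1 hs
    have hcs := hT.isFace_simplexCarrier hP hs'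
    constructor
    · rintro ⟨hG, hvG⟩
      have h2 := (hT.simplexCarrier_subset_iff hconv hs' hcs).1 subset_rfl
      exact ⟨h2.trans hG.1.subset, fun h => hvG (h2 (subset_convexHull ℝ _ h))⟩
    · rintro ⟨hsF, hvs⟩
      obtain ⟨G, hG, hvG, hsG⟩ := hTF.exists_face_notMem hFpoly hvT ⟨hs', hsF⟩ hvs
      have hsub := (hT.simplexCarrier_subset_iff hconv hs' (hF.trans hP hG)).2 hsG
      have hvc : v F ∉ simplexCarrier P s := fun h => hvG (hsub h)
      refine ⟨⟨(hF.isFace_iff hP).2 ⟨hcs, hsub.trans hG.subset⟩, fun h => hvc ?_⟩, hvc⟩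
      rw [h]
      exact hvF.1
  have hnum : ∀ n : ℕ, polytopeNumber v F (n + 2) =
      ∑ s ∈ hTF.1.toFinset, (n.choose (#s - 1) : ℤ) := by
    intro n
    induction n with
    | zero =>
      rw [polytopeNumber, if_neg hd, hrec 0, polytopeNumber,
        hTF.sum_cone hFpoly.convex hvT hvF.1 fun k => (Nat.choose 0 (k - 1) : ℤ)]
      congr 1
      refine Finset.sum_congr rfl fun s hs => ?_
      have hs0 : #s ≠ 0 := (Finset.card_pos.2 ((restrict K F).nonempty_of_mem_faces
        (hTF.1.mem_toFinset.1 (Finset.mem_filter.1 hs).1))).ne'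
      simp [Nat.choose_eq_zero_of_lt (Nat.pos_of_ne_zero hs0)]
    | succ n ihn =>
      rw [polytopeNumber, if_neg hd, hrec (n + 1), ihn,
        hTF.sum_cone hFpoly.convex hvT hvF.1 fun k => (Nat.choose n (k - 1) : ℤ),
        hTF.sum_cone hFpoly.convex hvT hvF.1 fun k => (Nat.choose (n + 1) (k - 1) : ℤ),
        add_assoc, ← Finset.sum_add_distrib]
      congr 1
      · simp
      refine Finset.sum_congr rfl fun s hs => ?_
      obtain ⟨k, hk⟩ := Nat.exists_eq_succ_of_ne_zero (Finset.card_pos.2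
        ((restrict K F).nonempty_of_mem_faces
          (hTF.1.mem_toFinset.1 (Finset.mem_filter.1 hs).1))).ne'
      rw [hk]
      simp only [Nat.succ_eq_add_one, Nat.add_sub_cancel]
      rw [Nat.choose_succ_succ n k]
      push_cast
      ring
  refine ⟨hTF_eq ▸ hnum n, ?_⟩
  -- The interior number discards the simplices whose smallest face is not `F`.
  have h1 : ∀ G : {G : Set E // IsProperFace F G}, interiorNumber v G.1 (n + 2) =
      ∑ s ∈ hT.1.toFinset with simplexCarrier P s = G.1, (n.choose (#s - 1) : ℤ) := fun G =>
    (ih _ G.2.dim_lt (hF.trans hP G.2.1) n rfl).2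
  rw [interiorNumber, if_neg hd, hnum n, hTF_eq, finsum_congr h1,
    finsum_simplexCarrier hP _ _ fun G hG => hF.trans hP hG.1, sub_eq_iff_eq_add,
    ← Finset.sum_filter_add_sum_filter_not _ fun s => simplexCarrier P s = F]
  congr 1
  all_goals
    rw [Finset.filter_filter]
    refine Finset.sum_congr (Finset.filter_congr fun s hs => ?_) fun _ _ => rfl
    have hs' := hT.1.mem_toFinset.1 hs
    rw [← hT.simplexCarrier_subset_iff hconv hs' hF]
  · exact ⟨fun h => h.2, fun h => ⟨h.subset, h⟩⟩
  · exact ⟨fun h => ⟨(hF.isFace_iff hP).2 ⟨hT.isFace_simplexCarrier hP hs', h.1⟩, h.2⟩,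
      fun h => ⟨h.1.subset, h.2⟩⟩

end Numbers

/-! ### The `h`-vector -/

section HVector

open Finset Geometry

theorem simplexNumber_of_nonpos (d : ℕ) {m : ℤ} (h : m ≤ 0) : simplexNumber d m = 0 := if_pos h

theorem simplexNumber_natCast_add_one (d k : ℕ) :
    simplexNumber d (k + 1) = ((k + d).choose d : ℤ) := by
  rw [simplexNumber, if_neg (by omega)]
  congr 2
  omega

theorem simplexNumber_sub (d : ℕ) (m : ℤ) :
    simplexNumber (d + 1) (m - 1) - simplexNumber (d + 1) m = -simplexNumber d m := by
  rcases le_or_gt m 0 with h | h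
  · rw [simplexNumber_of_nonpos _ h, simplexNumber_of_nonpos _ h,
      simplexNumber_of_nonpos _ (by omega)]
    simp
  · obtain ⟨k, rfl⟩ : ∃ k : ℕ, m = k + 1 := ⟨(m - 1).toNat, by omega⟩
    rw [simplexNumber_natCast_add_one, simplexNumber_natCast_add_one]
    cases k with
    | zero => rw [simplexNumber_of_nonpos _ (by simp)]; simp
    | succ k =>
      rw [show ((k + 1 : ℕ) : ℤ) + 1 - 1 = (k : ℤ) + 1 by push_cast; ring,
        simplexNumber_natCast_add_one, show k + 1 + (d + 1) = (k + 1 + d) + 1 by ring,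
        Nat.choose_succ_succ, show k + (d + 1) = k + 1 + d by ring]
      push_cast
      ring

theorem fwdDiff_iter_simplexNumber (d e : ℕ) (m : ℤ) :
    (fwdDiff (-1 : ℤ))^[e] (simplexNumber (d + e)) m = (-1) ^ e * simplexNumber d m := by
  induction e generalizing d m with
  | zero => simp
  | succ e ih =>
    rw [Function.iterate_succ_apply', fwdDiff, show d + (e + 1) = (d + 1) + e by ring, ih, ih,
      ← mul_sub, ← sub_eq_add_neg, simplexNumber_sub]
    ring

theorem alternating_sum_eq_fwdDiff_iter (g : ℤ → ℤ) (e : ℕ) (m : ℤ) :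
    ∑ k ∈ range (e + 1), (-1) ^ k * (e.choose k : ℤ) * g (m - k) =
      (-1) ^ e * (fwdDiff (-1 : ℤ))^[e] g m := by
  rw [fwdDiff_iter_eq_sum_shift, Finset.mul_sum]
  refine Finset.sum_congr rfl fun k hk => ?_
  obtain ⟨j, rfl⟩ := Nat.exists_eq_add_of_le (Nat.lt_succ_iff.1 (Finset.mem_range.1 hk))
  rw [Nat.add_sub_cancel_left, smul_eq_mul, pow_add]
  have h : ((-1 : ℤ) ^ j) * (-1) ^ j = 1 := by rw [← mul_pow]; simp
  simp only [nsmul_eq_mul, mul_neg, mul_one, ← sub_eq_add_neg]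
  linear_combination (-(-1 : ℤ) ^ k * ((k + j).choose k : ℤ) * g (m - k)) * h

/-- The contribution of the simplices with `i` vertices to the sum of the theorem: it is an iterated
difference of simplex numbers. -/
theorem sum_choose_mul_simplexNumber (d n i : ℕ) (hi : i ≤ d + 1) :
    ∑ k ∈ range (d + 1 - i + 1), (-1) ^ k * ((d + 1 - i).choose k : ℤ) *
        simplexNumber d (n + 2 - i - k) = if i = 0 then 0 else (n.choose (i - 1) : ℤ) := by
  rw [alternating_sum_eq_fwdDiff_iter]
  have hsq : ∀ e : ℕ, ((-1 : ℤ) ^ e) * (-1) ^ e = 1 := fun e => by rw [← mul_pow]; simp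
  cases i with
  | zero =>
    have h := fwdDiff_iter_simplexNumber 0 d
    rw [zero_add] at h
    rw [Nat.sub_zero, Function.iterate_succ_apply', fwdDiff, h, h]
    have h1 := simplexNumber_natCast_add_one 0 n
    have h2 := simplexNumber_natCast_add_one 0 (n + 1)
    rw [show ((n : ℤ) + 2 - (0 : ℕ) + -1) = n + 1 by push_cast; ring, h1,
      show ((n : ℤ) + 2 - (0 : ℕ)) = ((n + 1 : ℕ) : ℤ) + 1 by push_cast; ring, h2]
    simp
  | succ i =>
    obtain ⟨e, rfl⟩ := Nat.exists_eq_add_of_le (Nat.le_of_succ_le_succ hi)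
    rw [show i + e + 1 - (i + 1) = e by omega, fwdDiff_iter_simplexNumber, ← mul_assoc, hsq,
      one_mul, if_neg (Nat.succ_ne_zero i), Nat.add_sub_cancel]
    rcases Nat.lt_or_ge n i with hlt | hge
    · rw [simplexNumber_of_nonpos _ (by push_cast; omega), Nat.choose_eq_zero_of_lt hlt]
      rfl
    · obtain ⟨k, rfl⟩ := Nat.exists_eq_add_of_le hge
      rw [show (((i + k : ℕ) : ℤ) + 2 - (i + 1 : ℕ)) = (k : ℤ) + 1 by push_cast; ring,
        simplexNumber_natCast_add_one, add_comm k i]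

variable {K : SimplicialComplex ℝ E} {P : Set E} {a : E}

theorem sum_hEntry_mul_simplexNumber (K : SimplicialComplex ℝ E) (d n : ℕ) :
    ∑ j ∈ range (d + 2), hEntry K d j * simplexNumber d (n + 2 - j) =
      ∑ i ∈ range (d + 2), (faceCount K i : ℤ) * if i = 0 then 0 else (n.choose (i - 1) : ℤ) := by
  simp only [hEntry, Finset.sum_mul]
  rw [Finset.sum_comm' (t' := range (d + 2)) (s' := fun i => Ico i (d + 2))
    (by intro j i; simp only [Finset.mem_range, Finset.mem_Ico]; omega)]
  refine Finset.sum_congr rfl fun i hi => ?_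
  have hi' : i ≤ d + 1 := Nat.lt_succ_iff.1 (Finset.mem_range.1 hi)
  rw [← sum_choose_mul_simplexNumber d n i hi', Finset.mul_sum, Finset.sum_Ico_eq_sum_range,
    show d + 2 - i = d + 1 - i + 1 by omega]
  refine Finset.sum_congr rfl fun k hk => ?_
  have hk' : k ≤ d + 1 - i := Nat.lt_succ_iff.1 (Finset.mem_range.1 hk)
  rw [Nat.add_sub_cancel_left, show d + 1 - (i + k) = d + 1 - i - k by omega, Nat.choose_symm hk']
  push_cast
  rw [← sub_sub]
  ring

theorem IsTriangulation.faceCount_eq (hK : IsTriangulation P K) (i : ℕ) :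
    faceCount K i = #(hK.simplices.filter fun s => #s = i) := by
  rw [faceCount, ← Set.ncard_coe_finset]
  congr 1
  ext s
  simp [hK.mem_simplices]

theorem hEntry_zero (K : SimplicialComplex ℝ E) (d : ℕ) : hEntry K d 0 = 1 := by
  have h : {s : Finset E | (s = ∅ ∨ s ∈ K.faces) ∧ #s = 0} = {∅} := by
    ext s
    exact ⟨fun h => Finset.card_eq_zero.1 h.2, fun h => ⟨Or.inl h, Finset.card_eq_zero.2 h⟩⟩
  have h1 : faceCount K 0 = 1 := by rw [faceCount, h, Set.ncard_singleton]
  simp [hEntry, h1]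

variable [FiniteDimensional ℝ E]

theorem IsTriangulation.sum_simplices_eq (hK : IsTriangulation P K) (φ : ℕ → ℤ) :
    ∑ s ∈ hK.simplices, φ #s = ∑ i ∈ range (dim P + 2), (faceCount K i : ℤ) * φ i := by
  have hmaps : ∀ s ∈ hK.simplices, #s ∈ range (dim P + 2) := fun s hs => by
    rcases hK.mem_simplices.1 hs with rfl | hs
    · simp
    · exact Finset.mem_range.2 (Nat.lt_succ_iff.2 (card_le_dim_add_one (K.indep hs) (hK.subset hs)))
  rw [← Finset.sum_fiberwise_of_maps_to hmaps]
  refine Finset.sum_congr rfl fun i _ => ?_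
  rw [Finset.sum_congr rfl fun s hs => by rw [(Finset.mem_filter.1 hs).2], Finset.sum_const,
    nsmul_eq_mul, hK.faceCount_eq]

theorem neg_one_pow_sub {k i : ℕ} (h : i ≤ k) : (-1 : ℤ) ^ (k - i) = (-1) ^ k * (-1) ^ i := by
  obtain ⟨j, rfl⟩ := Nat.exists_eq_add_of_le h
  rw [Nat.add_sub_cancel_left, pow_add, mul_right_comm, ← mul_pow]
  simp

/-- The last two entries of the `h`-vector vanish for a cone over a vertex of the polytope. -/
theorem IsTriangulation.hEntry_eq_zero (hP : IsPolytope P) (hK : IsTriangulation P K)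
    (hd : 1 ≤ dim P) (ha : a ∈ P.extremePoints ℝ)
    (haT : ∀ T ∈ K.faces, #T = dim P + 1 → a ∈ T) :
    hEntry K (dim P) (dim P) = 0 ∧ hEntry K (dim P) (dim P + 1) = 0 := by
  obtain ⟨h1, h2⟩ := hK.alternating_sums hP hd ha haT
  rw [hK.sum_simplices_eq fun k => (-1) ^ k] at h1
  rw [hK.sum_simplices_eq fun k => (-1) ^ k * (k : ℤ)] at h2
  set d := dim P
  have hlast : hEntry K d (d + 1) = (-1) ^ (d + 1) *
      ∑ i ∈ range (d + 2), (faceCount K i : ℤ) * (-1) ^ i := by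
    rw [hEntry, Finset.mul_sum]
    refine Finset.sum_congr rfl fun i hi => ?_
    rw [neg_one_pow_sub (Nat.lt_succ_iff.1 (Finset.mem_range.1 hi)), Nat.sub_self,
      Nat.choose_zero_right]
    push_cast
    ring
  have hlast' : hEntry K d d = (-1) ^ d *
      ∑ i ∈ range (d + 2), ((d + 1) * ((faceCount K i : ℤ) * (-1) ^ i) -
        (faceCount K i : ℤ) * ((-1) ^ i * (i : ℤ))) := by
    rw [hEntry, Finset.sum_range_succ _ (d + 1), mul_add, Finset.mul_sum]
    -- The additional summand, for `i = d + 1`, is zero.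
    rw [show ∀ x y z : ℤ, z = 0 → (x = y + z ↔ x = y) from fun x y z h => by rw [h, add_zero]]
    · refine Finset.sum_congr rfl fun i hi => ?_
      have hi' : i ≤ d := Nat.lt_succ_iff.1 (Finset.mem_range.1 hi)
      rw [neg_one_pow_sub hi', show d + 1 - d = 1 by omega, Nat.choose_one_right,
        Nat.cast_sub (by omega)]
      push_cast
      ring
    · push_cast
      ring
  rw [hlast', hlast, Finset.sum_sub_distrib, ← Finset.mul_sum, h1, h2]
  simp

theorem IsPointedTriangulation.polytopeNumber_eq (hP : IsPolytope P) (hd : 1 ≤ dim P)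
    {v : Set E → E} (hK : IsPointedTriangulation P K v) (n : ℕ) :
    polytopeNumber v P n = ∑ j ∈ range (dim P), hEntry K (dim P) j *
      simplexNumber (dim P) ((n : ℤ) - (j : ℤ)) := by
  classical
  have hT := hK.isTriangulation
  have hne : P.Nonempty := by
    by_contra h
    rw [Set.not_nonempty_iff_eq_empty.1 h] at hd
    simp [dim] at hd
  have hPP := IsFace.refl hne
  obtain ⟨h1, h2⟩ := hT.hEntry_eq_zero hP hd (hK.apex_mem_vertices P hPP) fun T hT' hcard =>
    hK.apex_mem_simplex P hPP T ⟨hT', hT.convexHull_subset hT'⟩ hcard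
  match n with
  | 0 =>
    rw [polytopeNumber]
    refine (Finset.sum_eq_zero fun j _ => ?_).symm
    rw [simplexNumber_of_nonpos _ (by push_cast; omega), mul_zero]
  | 1 =>
    rw [polytopeNumber, Finset.sum_eq_single_of_mem 0 (Finset.mem_range.2 hd), hEntry_zero]
    · have := simplexNumber_natCast_add_one (dim P) 0
      simp only [Nat.cast_zero, zero_add] at this
      simp [this]
    · intro j _ hj
      rw [simplexNumber_of_nonpos _ (by push_cast; omega), mul_zero]
  | n + 2 =>
    have h3 := sum_hEntry_mul_simplexNumber K (dim P) n
    rw [Finset.sum_range_succ, Finset.sum_range_succ, h1, h2, zero_mul, zero_mul, add_zero,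
      add_zero, ← hT.sum_simplices_eq fun i => if i = 0 then 0 else (n.choose (i - 1) : ℤ)] at h3
    push_cast
    rw [h3, (hK.numbers_eq hP hPP n).1, IsTriangulation.simplices,
      Finset.sum_insert (by simpa using K.empty_notMem), Finset.card_empty, if_pos rfl, zero_add,
      Finset.filter_true_of_mem fun s hs => hT.convexHull_subset (hT.1.mem_toFinset.1 hs)]
    refine Finset.sum_congr rfl fun s hs => ?_
    rw [if_neg (Finset.card_pos.2 (K.nonempty_of_mem_faces (hT.1.mem_toFinset.1 hs))).ne']

end HVector

/-! ### Pulling triangulations -/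

section Pulling

open Finset Geometry

variable {s t : Finset E} {x y a w : E} {P F G : Set E} {r : E → ℕ}

open Classical in
/-- The vertex of `F` of smallest rank `r` (and `0` if `F` has no vertices). -/
def apex (r : E → ℕ) (F : Set E) : E :=
  if h : (F.extremePoints ℝ).Nonempty then Function.argminOn r _ h else 0

theorem IsFace.nonempty_extremePoints (hP : IsPolytope P) (hF : IsFace P F) :
    (F.extremePoints ℝ).Nonempty :=
  ((hF.isPolytope hP).isCompact).extremePoints_nonempty hF.2

theorem apex_mem (hP : IsPolytope P) (hF : IsFace P F) : apex r F ∈ F.extremePoints ℝ := by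
  rw [apex, dif_pos (hF.nonempty_extremePoints hP)]
  exact Function.argminOn_mem _ _ _

theorem rank_apex_le (hw : w ∈ F.extremePoints ℝ) : r (apex r F) ≤ r w := by
  rw [apex, dif_pos ⟨w, hw⟩]
  exact Function.argminOn_le _ _ hw

theorem IsFace.mem_extremePoints_iff (hF : IsFace P F) (hw : w ∈ F) :
    w ∈ F.extremePoints ℝ ↔ w ∈ P.extremePoints ℝ := by
  rw [hF.extremePoints_eq]
  exact ⟨fun h => h.2, fun h => ⟨hw, h⟩⟩

theorem IsFace.apex_mem_extremePoints (hP : IsPolytope P) (hF : IsFace P F) :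
    apex r F ∈ P.extremePoints ℝ :=
  hF.1.isExtreme.extremePoints_subset_extremePoints (apex_mem hP hF)

/-- A face inside `F` that contains the apex of `F` has the same apex. -/
theorem apex_eq_of_subset (hP : IsPolytope P) (hr : Set.InjOn r (P.extremePoints ℝ))
    (hF : IsFace P F) (hG : IsFace P G) (hGF : G ⊆ F) (h : apex r F ∈ G) :
    apex r G = apex r F := by
  refine hr (hG.apex_mem_extremePoints hP) (hF.apex_mem_extremePoints hP) (le_antisymm ?_ ?_)
  · exact rank_apex_le ((hG.mem_extremePoints_iff h).2 (hF.apex_mem_extremePoints hP))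
  · exact rank_apex_le ((hF.mem_extremePoints_iff (hGF (apex_mem hP hG).1)).2
      (hG.apex_mem_extremePoints hP))

theorem subset_simplexCarrier (hP : IsPolytope P) (hsP : (s : Set E) ⊆ P) (hs : s.Nonempty) :
    (s : Set E) ⊆ simplexCarrier P s :=
  (simplexCarrier_subset_iff hP.convex hsP hs (isFace_simplexCarrier hP hsP hs)).1 subset_rfl

theorem carrier_eq_of_mem_openSimplex (hP : IsPolytope P) (hsP : (s : Set E) ⊆ P)
    (hx : x ∈ openSimplex s) : carrier P x = simplexCarrier P s := by
  have hs := openSimplex_nonempty_index hx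
  have hxP : x ∈ P := convexHull_min hsP hP.convex (openSimplex_subset_convexHull hx)
  refine Set.Subset.antisymm (carrier_subset (isFace_simplexCarrier hP hsP hs) ?_) ?_
  · exact convexHull_min (subset_simplexCarrier hP hsP hs)
      ((isFace_simplexCarrier hP hsP hs).1.convex hP.convex) (openSimplex_subset_convexHull hx)
  · rw [simplexCarrier_subset_iff hP.convex hsP hs (isFace_carrier hP hxP)]
    exact (subset_convexHull ℝ _).trans
      ((isFace_carrier hP hxP).convexHull_subset hP.convex hsP hx mem_carrier)

/-- The simplices of the pulling triangulation of `P`, for the order of the vertices by the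
rank `r`: sets of vertices such that each nonempty subset contains the apex of the smallest face
around it. -/
def IsPulled (P : Set E) (r : E → ℕ) (s : Finset E) : Prop :=
  (s : Set E) ⊆ P.extremePoints ℝ ∧
    ∀ t ⊆ s, t.Nonempty → apex r (simplexCarrier P t) ∈ t

theorem IsPulled.subset (h : IsPulled P r s) : (s : Set E) ⊆ P :=
  h.1.trans extremePoints_subset

theorem IsPulled.mono (h : IsPulled P r s) (hts : t ⊆ s) : IsPulled P r t :=
  ⟨(Finset.coe_subset.2 hts).trans h.1, fun u hu => h.2 u (hu.trans hts)⟩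

/-- Pulling the apex of a face: a cone over a pulled simplex in the face is pulled. -/
theorem IsPulled.insert_apex [DecidableEq E] (hP : IsPolytope P)
    (hr : Set.InjOn r (P.extremePoints ℝ)) (hF : IsFace P F) (h : IsPulled P r s)
    (hsF : (s : Set E) ⊆ F) : IsPulled P r (insert (apex r F) s) := by
  have hsub : ((insert (apex r F) s : Finset E) : Set E) ⊆ F := by
    rw [Finset.coe_insert]
    exact Set.insert_subset (apex_mem hP hF).1 hsF
  refine ⟨?_, fun t ht hne => ?_⟩
  · rw [Finset.coe_insert]
    exact Set.insert_subset (hF.apex_mem_extremePoints hP) h.1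
  by_cases hat : apex r F ∈ t
  · have htF := (Finset.coe_subset.2 ht).trans hsub
    have htP := htF.trans hF.subset
    rw [apex_eq_of_subset hP hr hF (isFace_simplexCarrier hP htP hne)
      ((simplexCarrier_subset_iff hP.convex htP hne hF).2 htF)
      (subset_simplexCarrier hP htP hne hat)]
    exact hat
  · exact h.2 t ((Finset.subset_insert_iff_of_notMem hat).1 ht) hne

theorem isPulled_empty : IsPulled P r ∅ :=
  ⟨by simp, fun t ht hne => absurd (Finset.subset_empty.1 ht) hne.ne_empty⟩

theorem isPulled_singleton (hP : IsPolytope P) (hr : Set.InjOn r (P.extremePoints ℝ))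
    (hw : w ∈ P.extremePoints ℝ) : IsPulled P r {w} := by
  classical
  have hF := isFace_singleton hP hw
  have h := (isPulled_empty (P := P) (r := r)).insert_apex hP hr hF (by simp)
  rwa [(apex_mem hP hF).1, insert_empty_eq] at h

/-- The face around the vertices other than the apex does not contain the apex. -/
theorem IsPulled.apex_notMem_simplexCarrier_erase [DecidableEq E] (hP : IsPolytope P)
    (hr : Set.InjOn r (P.extremePoints ℝ)) (h : IsPulled P r s)
    (hne : (s.erase (apex r (simplexCarrier P s))).Nonempty) :
    apex r (simplexCarrier P s) ∉
      simplexCarrier P (s.erase (apex r (simplexCarrier P s))) := by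
  intro hmem
  have hs : s.Nonempty := hne.mono (Finset.erase_subset _ _)
  have h' := h.mono (Finset.erase_subset (apex r (simplexCarrier P s)) s)
  have h1 := h'.2 _ subset_rfl hne
  have hF := isFace_simplexCarrier hP h.subset hs
  rw [apex_eq_of_subset hP hr hF (isFace_simplexCarrier hP h'.subset hne)
    ((simplexCarrier_subset_iff hP.convex h'.subset hne hF).2 ?_) hmem] at h1
  · exact Finset.notMem_erase _ _ h1
  · exact (Finset.coe_subset.2 (Finset.erase_subset _ _)).trans
      (subset_simplexCarrier hP h.subset hs)

/-- Affine independence is preserved by adding a point off a face that contains the others. -/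
theorem affineIndependent_of_erase [DecidableEq E] (hG : IsFace P G) (ha : a ∈ P) (has : a ∈ s)
    (haG : a ∉ G) (hsG : ((s.erase a : Finset E) : Set E) ⊆ G)
    (h : AffineIndependent ℝ ((↑) : ↥(s.erase a) → E)) :
    AffineIndependent ℝ ((↑) : s → E) := by
  refine AffineIndependent.affineIndependent_of_notMem_span (i := ⟨a, has⟩) ?_ fun hmem => ?_
  · exact h.comp_embedding (⟨fun x => ⟨x.1.1, Finset.mem_erase.2
      ⟨fun h => x.2 (Subtype.ext h), x.1.2⟩⟩, fun x y hxy =>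
        Subtype.ext (Subtype.ext (congrArg (fun z : ↥(s.erase a) => (z : E)) hxy))⟩ :
        {y : s // y ≠ ⟨a, has⟩} ↪ (s.erase a : Finset E))
  · obtain ⟨l, m, hl1, -, hl3⟩ := hG.exists_functional
    have h1 : affineSpan ℝ ((↑) '' {x : s | x ≠ ⟨a, has⟩}) ≤
        (AffineSubspace.mk' (m : ℝ) ⊥).comap l.toLinearMap.toAffineMap := by
      rw [affineSpan_le]
      rintro _ ⟨x, hx, rfl⟩
      have hxm : l x = m := hl1 _ (hsG (Finset.mem_coe.2 (Finset.mem_erase.2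
        ⟨fun h => hx (Subtype.ext h), x.2⟩)))
      simp [AffineSubspace.mem_mk', hxm]
    have h2 := h1 hmem
    have h3 : l a - m = 0 := by simpa [AffineSubspace.mem_mk'] using h2
    linarith [hl3 a ha haG]

theorem IsPulled.affineIndependent (hP : IsPolytope P) (hr : Set.InjOn r (P.extremePoints ℝ))
    (h : IsPulled P r s) : AffineIndependent ℝ ((↑) : s → E) := by
  classical
  induction s using Finset.strongInduction with
  | H s ih =>
  rcases s.eq_empty_or_nonempty with rfl | hs
  · exact affineIndependent_of_subsingleton ℝ _
  have ha := h.2 s subset_rfl hs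
  have h' := h.mono (Finset.erase_subset (apex r (simplexCarrier P s)) s)
  rcases (s.erase (apex r (simplexCarrier P s))).eq_empty_or_nonempty with he | hne
  · have hmem : ∀ x ∈ s, x = apex r (simplexCarrier P s) := fun x hx => Finset.mem_singleton.1
      (((Finset.erase_eq_empty_iff _ _).1 he).resolve_left hs.ne_empty ▸ hx)
    have hsub : Subsingleton s :=
      ⟨fun x y => Subtype.ext ((hmem _ x.2).trans (hmem _ y.2).symm)⟩
    exact affineIndependent_of_subsingleton ℝ _
  · exact affineIndependent_of_erase (isFace_simplexCarrier hP h'.subset hne) (h.subset ha) ha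
      (h.apex_notMem_simplexCarrier_erase hP hr hne) (subset_simplexCarrier hP h'.subset hne)
      (ih _ (Finset.erase_ssubset ha) h')

/-- A point of the relative interior of a simplex lies between a vertex and a point of the relative
interior of the opposite facet. -/
theorem exists_mem_openSimplex_erase [DecidableEq E] (hx : x ∈ openSimplex s) (ha : a ∈ s)
    (hne : (s.erase a).Nonempty) : ∃ y ∈ openSimplex (s.erase a), ∃ ε : ℝ, 0 < ε ∧ ε < 1 ∧
      x = AffineMap.lineMap a y ε := by
  obtain ⟨c, hc, hc1, rfl⟩ := hx
  have hpos : 0 < ∑ e ∈ s.erase a, c e :=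
    Finset.sum_pos (fun e he => hc e (Finset.mem_of_mem_erase he)) hne
  rw [← Finset.add_sum_erase s _ ha] at hc1
  refine ⟨_, ⟨fun e => (∑ e ∈ s.erase a, c e)⁻¹ * c e, fun e he => mul_pos (inv_pos.2 hpos)
    (hc e (Finset.mem_of_mem_erase he)), ?_, rfl⟩, ∑ e ∈ s.erase a, c e, hpos,
    by linarith [hc a ha], ?_⟩
  · rw [← Finset.mul_sum, inv_mul_cancel₀ hpos.ne']
  · simp only [mul_smul]
    rw [← Finset.smul_sum, AffineMap.lineMap_apply_module, smul_smul, mul_inv_cancel₀ hpos.ne',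
      one_smul, ← Finset.add_sum_erase s _ ha]
    congr 2
    linarith

/-- On a ray from `a`, two points of faces that do not contain `a` coincide. -/
theorem eq_of_lineMap_eq (hF : IsFace P F) (hG : IsFace P G) (ha : a ∈ P) (haF : a ∉ F)
    (haG : a ∉ G) (hy : y ∈ F) (hw : w ∈ G) {δ ε : ℝ} (hδ : 0 < δ) (hε : 0 < ε)
    (h : AffineMap.lineMap a y δ = AffineMap.lineMap a w ε) : y = w := by
  wlog hle : δ ≤ ε generalizing F G y w δ ε
  · exact (this hG hF haG haF hw hy hε hδ h.symm (not_le.1 hle).le).symm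
  have h1 : AffineMap.lineMap a y (δ / ε) = w := by
    have h2 : AffineMap.lineMap a (AffineMap.lineMap a y δ) ε⁻¹ = w := by
      rw [h, AffineMap.lineMap_lineMap_right, inv_mul_cancel₀ hε.ne', AffineMap.lineMap_apply_one]
    rwa [AffineMap.lineMap_lineMap_right, mul_comm, ← div_eq_mul_inv] at h2
  rcases hle.eq_or_lt with rfl | hlt
  · rwa [div_self hε.ne', AffineMap.lineMap_apply_one] at h1
  · exfalso
    refine haG (hG.mem_of_mem_openSegment ha (hF.subset hy) hw ?_)
    rw [openSegment_eq_image_lineMap]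
    exact ⟨δ / ε, ⟨by positivity, (div_lt_one hε).2 hlt⟩, h1⟩

/-- The relative interiors of the simplices of the pulling triangulation are disjoint. -/
theorem IsPulled.eq_of_mem_openSimplex (hP : IsPolytope P)
    (hr : Set.InjOn r (P.extremePoints ℝ)) (hs : IsPulled P r s) (ht : IsPulled P r t)
    (hxs : x ∈ openSimplex s) (hxt : x ∈ openSimplex t) : s = t := by
  classical
  induction s using Finset.strongInduction generalizing t x with
  | H s ih =>
  have hsne := openSimplex_nonempty_index hxs
  have htne := openSimplex_nonempty_index hxt
  have hcar : simplexCarrier P s = simplexCarrier P t :=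
    (carrier_eq_of_mem_openSimplex hP hs.subset hxs).symm.trans
      (carrier_eq_of_mem_openSimplex hP ht.subset hxt)
  have has := hs.2 s subset_rfl hsne
  have hat := ht.2 t subset_rfl htne
  have hs1 := fun h => hs.apex_notMem_simplexCarrier_erase hP hr h
  have ht1 := fun h => ht.apex_notMem_simplexCarrier_erase hP hr h
  rw [← hcar] at hat ht1
  have hF := isFace_singleton hP (hs.1 has)
  have hs' := hs.mono (Finset.erase_subset (apex r (simplexCarrier P s)) s)
  have ht' := ht.mono (Finset.erase_subset (apex r (simplexCarrier P s)) t)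
  have hst := simplexCarrier_subset_iff hP.convex hs.subset hsne hF
  have htt := simplexCarrier_subset_iff hP.convex ht.subset htne hF
  rw [← hcar, hst] at htt
  rcases (s.erase (apex r (simplexCarrier P s))).eq_empty_or_nonempty with hes | hnes
  · have h1 : s = {apex r (simplexCarrier P s)} :=
      ((Finset.erase_eq_empty_iff _ _).1 hes).resolve_left hsne.ne_empty
    have h2 := htt.1 (by exact_mod_cast h1.subset)
    have h3 : t ⊆ {apex r (simplexCarrier P s)} := by exact_mod_cast h2
    exact h1.trans ((Finset.subset_singleton_iff.1 h3).resolve_left htne.ne_empty).symm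
  rcases (t.erase (apex r (simplexCarrier P s))).eq_empty_or_nonempty with het | hnet
  · have h1 : t = {apex r (simplexCarrier P s)} :=
      ((Finset.erase_eq_empty_iff _ _).1 het).resolve_left htne.ne_empty
    have h2 := htt.2 (by exact_mod_cast h1.subset)
    have h3 : s ⊆ {apex r (simplexCarrier P s)} := by exact_mod_cast h2
    exact ((Finset.subset_singleton_iff.1 h3).resolve_left hsne.ne_empty).trans h1.symm
  obtain ⟨y, hy, δ, hδ, -, hxy⟩ := exists_mem_openSimplex_erase hxs has hnes
  obtain ⟨z, hz, ε, hε, -, hxz⟩ := exists_mem_openSimplex_erase hxt hat hnet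
  have hyF := carrier_eq_of_mem_openSimplex hP hs'.subset hy
  have hzF := carrier_eq_of_mem_openSimplex hP ht'.subset hz
  have hyz : y = z := eq_of_lineMap_eq (isFace_simplexCarrier hP hs'.subset hnes)
    (isFace_simplexCarrier hP ht'.subset hnet) (hs.subset has) (hs1 hnes) (ht1 hnet)
    (hyF ▸ mem_carrier) (hzF ▸ mem_carrier) hδ hε (hxy.symm.trans hxz)
  subst hyz
  rw [← Finset.insert_erase has, ← Finset.insert_erase hat,
    ih _ (Finset.erase_ssubset has) hs' ht' hy hz]

/-- The ray from `a` through another point `x` of a polytope leaves the polytope at a point that has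
a face around it without `a`. -/
theorem exists_exit_point (hP : IsPolytope P) (hx : x ∈ P) (hne : x ≠ a) :
    ∃ y ∈ P, x ∈ segment ℝ a y ∧ (x = y ∨ x ∈ openSegment ℝ y a) ∧
      ∃ G, IsFace P G ∧ y ∈ G ∧ a ∉ G := by
  have hcont : Continuous fun ε : ℝ => AffineMap.lineMap a x ε := AffineMap.lineMap_continuous
  obtain ⟨C, hC⟩ := hP.isCompact.isBounded.exists_norm_le
  have hpos : 0 < ‖x - a‖ := norm_pos_iff.2 (sub_ne_zero.2 hne)
  have hcpt : IsCompact {ε : ℝ | 1 ≤ ε ∧ AffineMap.lineMap a x ε ∈ P} := by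
    refine (isCompact_Icc (a := (1 : ℝ)) (b := (C + ‖a‖) / ‖x - a‖)).of_isClosed_subset
      (isClosed_Ici.inter (hP.isCompact.isClosed.preimage hcont)) fun ε hε => ⟨hε.1, ?_⟩
    rw [le_div_iff₀ hpos]
    have h1 := hC _ hε.2
    have h2 : ε • (x - a) = AffineMap.lineMap a x ε - a := by
      rw [AffineMap.lineMap_apply_module']
      abel
    have h3 := norm_sub_le (AffineMap.lineMap a x ε) a
    rw [← h2, norm_smul, Real.norm_of_nonneg (zero_le_one.trans hε.1)] at h3
    linarith
  obtain ⟨ε, ⟨hε1, hεP⟩, hmax⟩ := hcpt.exists_isGreatest ⟨1, le_rfl, by simpa using hx⟩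
  have hε0 : 0 < ε := one_pos.trans_le hε1
  have hx' : AffineMap.lineMap a (AffineMap.lineMap a x ε) ε⁻¹ = x := by
    rw [AffineMap.lineMap_lineMap_right, inv_mul_cancel₀ hε0.ne', AffineMap.lineMap_apply_one]
  refine ⟨_, hεP, ?_, ?_, ?_⟩
  · rw [segment_eq_image_lineMap]
    exact ⟨ε⁻¹, ⟨(inv_pos.2 hε0).le, inv_le_one_of_one_le₀ hε1⟩, hx'⟩
  · rcases hε1.eq_or_lt with rfl | hlt
    · left; simp
    · right
      rw [openSegment_symm, openSegment_eq_image_lineMap]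
      exact ⟨ε⁻¹, ⟨inv_pos.2 hε0, inv_lt_one_of_one_lt₀ hlt⟩, hx'⟩
  · by_contra! hcon
    obtain ⟨δ, hδ, hδP⟩ := hP.exists_prolong hεP hcon
    have h1 : AffineMap.lineMap a x ε + δ • (AffineMap.lineMap a x ε - a) =
        AffineMap.lineMap a x (ε * (1 + δ)) := by
      rw [AffineMap.lineMap_apply_module', AffineMap.lineMap_apply_module']
      module
    rw [h1] at hδP
    have h2 : ε * (1 + δ) ≤ ε := hmax ⟨by nlinarith, hδP⟩
    nlinarith [mul_pos hε0 hδ]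

variable [FiniteDimensional ℝ E]

/-- The simplices of the pulling triangulation cover the polytope. -/
theorem exists_isPulled_mem_convexHull (hP : IsPolytope P)
    (hr : Set.InjOn r (P.extremePoints ℝ)) (hx : x ∈ P) :
    ∃ s, IsPulled P r s ∧ x ∈ convexHull ℝ (s : Set E) := by
  classical
  induction hdim : dim (carrier P x) using Nat.strong_induction_on generalizing x with
  | _ k ih =>
  subst hdim
  have hF := isFace_carrier hP hx
  have ha := apex_mem (r := r) hP hF
  have haP := hF.apex_mem_extremePoints (r := r) hP
  by_cases hxa : x = apex r (carrier P x)
  · refine ⟨{apex r (carrier P x)}, isPulled_singleton hP hr haP, ?_⟩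
    simpa using hxa
  obtain ⟨y, hy, hxy, hxy', G, hG, hyG, haG⟩ := exists_exit_point hP hx hxa
  have hyF : y ∈ carrier P x := by
    rcases hxy' with rfl | h
    exacts [mem_carrier, hF.mem_of_mem_openSegment hy haP.1 mem_carrier h]
  have hyc : carrier P y ⊆ carrier P x := carrier_subset hF hyF
  have hac : apex r (carrier P x) ∉ carrier P y := fun h => haG (carrier_subset hG hyG h)
  have hproper : IsProperFace (carrier P x) (carrier P y) :=
    ⟨(hF.isFace_iff hP).2 ⟨isFace_carrier hP hy, hyc⟩, fun h => hac (h ▸ ha.1)⟩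
  obtain ⟨s, hs, hys⟩ := ih _ hproper.dim_lt hy rfl
  obtain ⟨t, hts, htne, hyt⟩ := exists_mem_openSimplex hys
  have ht := hs.mono hts
  have htF : (t : Set E) ⊆ carrier P x := by
    refine Set.Subset.trans ?_ hyc
    rw [carrier_eq_of_mem_openSimplex hP ht.subset hyt]
    exact subset_simplexCarrier hP ht.subset htne
  refine ⟨_, ht.insert_apex hP hr hF htF, ?_⟩
  refine (convex_convexHull ℝ _).segment_subset (subset_convexHull ℝ _ ?_) ?_ hxy
  · simp
  · exact convexHull_mono (Finset.coe_subset.2 (Finset.subset_insert _ _))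
      (openSimplex_subset_convexHull hyt)

/-- The pulling triangulation of `P` for the order of its vertices by the rank `r`. -/
def pulling (hP : IsPolytope P) (hr : Set.InjOn r (P.extremePoints ℝ)) :
    SimplicialComplex ℝ E where
  faces := {s | s.Nonempty ∧ IsPulled P r s}
  isRelLowerSet_faces := fun _ hs => ⟨hs.1, fun _ hts ht => ⟨ht, hs.2.mono hts⟩⟩
  indep := fun hs => hs.2.affineIndependent hP hr
  inter_subset_convexHull := by
    rintro s t hs ht x ⟨hxs, hxt⟩
    obtain ⟨s', hs', -, hxs'⟩ := exists_mem_openSimplex hxs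
    obtain ⟨t', ht', -, hxt'⟩ := exists_mem_openSimplex hxt
    obtain rfl := (hs.2.mono hs').eq_of_mem_openSimplex hP hr (ht.2.mono ht') hxs' hxt'
    exact convexHull_mono (Set.subset_inter (Finset.coe_subset.2 hs') (Finset.coe_subset.2 ht'))
      (openSimplex_subset_convexHull hxs')

theorem isTriangulation_pulling (hP : IsPolytope P) (hr : Set.InjOn r (P.extremePoints ℝ)) :
    IsTriangulation P (pulling hP hr) := by
  refine ⟨?_, Set.Subset.antisymm (fun x hx => ?_) fun x hx => ?_⟩
  · refine (hP.finite_extremePoints.toFinset.powerset.finite_toSet).subset fun s hs => ?_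
    rw [Finset.mem_coe, Finset.mem_powerset]
    exact fun e he => hP.finite_extremePoints.mem_toFinset.2 (hs.2.1 he)
  · obtain ⟨s, hs, hxs⟩ := SimplicialComplex.mem_space_iff.1 hx
    exact convexHull_min hs.2.subset hP.convex hxs
  · obtain ⟨s, hs, hxs⟩ := exists_isPulled_mem_convexHull hP hr hx
    refine SimplicialComplex.mem_space_iff.2 ⟨s, ⟨?_, hs⟩, hxs⟩
    exact_mod_cast convexHull_nonempty_iff.1 ⟨x, hxs⟩

theorem isPointedTriangulation_pulling (hP : IsPolytope P)
    (hr : Set.InjOn r (P.extremePoints ℝ)) :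
    IsPointedTriangulation P (pulling hP hr) (apex r) where
  isTriangulation := isTriangulation_pulling hP hr
  isTriangulation_face := fun _ hF => (isTriangulation_pulling hP hr).restrict hP.convex hF
  apex_mem_vertices := fun _ hF => apex_mem hP hF
  apex_mem_simplex := by
    intro F hF s hs hcard
    have hsF : (s : Set E) ⊆ F := (subset_convexHull ℝ _).trans hs.2
    have hs1 : s.Nonempty ∧ IsPulled P r s := hs.1
    have hc := isFace_simplexCarrier hP hs1.2.subset hs1.1
    have hcF := (simplexCarrier_subset_iff hP.convex hs1.2.subset hs1.1 hF).2 hsF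
    have heq : simplexCarrier P s = F := by
      by_contra hne
      have h1 := IsProperFace.dim_lt ⟨(hF.isFace_iff hP).2 ⟨hc, hcF⟩, hne⟩
      have h2 := card_le_dim_add_one (hs1.2.affineIndependent hP hr)
        (subset_simplexCarrier hP hs1.2.subset hs1.1)
      omega
    have h3 := hs1.2.2 s subset_rfl hs1.1
    rwa [heq] at h3
  apex_eq := by
    intro F₁ F₂ h₁ h₂ hv₁ hv₂
    have e₁ := h₁.apex_mem_extremePoints (r := r) hP
    have e₂ := h₂.apex_mem_extremePoints (r := r) hP
    exact hr e₁ e₂ (le_antisymm (rank_apex_le ((h₁.mem_extremePoints_iff hv₂.1).2 e₂))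
      (rank_apex_le ((h₂.mem_extremePoints_iff hv₁.2).2 e₁)))
  edge_mem := by
    classical
    intro F hF w hw _
    have hsF : ((insert (apex r F) {w} : Finset E) : Set E) ⊆ F := by
      rw [Finset.coe_insert, Finset.coe_singleton]
      exact Set.insert_subset (apex_mem hP hF).1 (Set.singleton_subset_iff.2 hw.1)
    refine ⟨insert (apex r F) {w}, ⟨⟨Finset.insert_nonempty _ _, ?_⟩,
      convexHull_min hsF (hF.1.convex hP.convex)⟩, by simp⟩
    exact (isPulled_singleton hP hr ((hF.mem_extremePoints_iff hw.1).1 hw)).insert_apex hP hr hF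
      (by simpa using hw.1)

/-- Every polytope has a pointed triangulation. -/
theorem exists_isPointedTriangulation (hP : IsPolytope P) :
    ∃ (K : SimplicialComplex ℝ E) (v : Set E → E), IsPointedTriangulation P K v := by
  obtain ⟨r, hr⟩ := Set.countable_iff_exists_injOn.1 hP.finite_extremePoints.countable
  exact ⟨pulling hP hr, apex r, isPointedTriangulation_pulling hP hr⟩

end Pulling

end PolytopeNumbers

end

theorem theorem1 (m d : ℕ) (hd : 1 ≤ d) (P : Set (EuclideanSpace ℝ (Fin m)))
    (hP : PolytopeNumbers.IsPolytope P) (hdim : PolytopeNumbers.dim P = d) :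
    (∃ (K : Geometry.SimplicialComplex ℝ (EuclideanSpace ℝ (Fin m)))
        (v : Set (EuclideanSpace ℝ (Fin m)) → EuclideanSpace ℝ (Fin m)),
        PolytopeNumbers.IsPointedTriangulation P K v) ∧
      ∀ (K : Geometry.SimplicialComplex ℝ (EuclideanSpace ℝ (Fin m)))
        (v : Set (EuclideanSpace ℝ (Fin m)) → EuclideanSpace ℝ (Fin m)),
        PolytopeNumbers.IsPointedTriangulation P K v →
        ∀ n : ℕ, PolytopeNumbers.polytopeNumber v P n =
          ∑ j ∈ Finset.range d,
            PolytopeNumbers.hEntry K d j * PolytopeNumbers.simplexNumber d ((n : ℤ) - (j : ℤ)) := by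
  subst hdim
  exact ⟨PolytopeNumbers.exists_isPointedTriangulation hP,
    fun K v hK n => hK.polytopeNumber_eq hP hd n⟩
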